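/- Fix a local dimension $d\ge1$, a degree bound $z$, a gap $\Delta>0$, and constants $c\ge1$, $p,q\ge0$. Consider any finite connected graph $G=(\mathcal V,\mathcal E)$ of maximal degree at most $z$, with $N=|\mathcal V|$ vertices and $K=|\mathcal E|$ edges, a $d$-level spin at each vertex, and a Hamiltonian $H=\sum_{e\in\mathcal E}h_e$, where each $h_e$ is self-adjoint, acts non-trivially only on the two endpoints of $e$, and satisfies $\|h_e\|\le1$. Let $E_0$ be the smallest eigenvalue of $H$ and $P$ the ground state projector, i.e. the orthogonal projection onto the eigenspace of $E_0$. Suppose that * (gap) every eigenvalue of $H$ other than $E_0$ is at least $E_0+\Delta$; * (polynomial density of states) for every $E\ge0$, the number of eigenvalues of $H$, counted with multiplicity, in $[E_0,E_0+E]$ is at most $(cN)^{pE+q}$. *Trotter/compression construction.* Choose any ordering $e_1,\dots,e_K$ of the edges. For $\beta\ge0$ and integers $M\ge1$, $L\ge0$ put $x_e=e^{-\beta h_e/2M}-1$ and let $(g_1,\dots,g_{2K})=(e_K,\dots,e_1,e_1,\dots,e_K)$. With $\tau=\prod_{i=1}^K e^{-\beta h_{e_i}/2M}$ one has $(\tau^\dagger\tau)^M=\prod_{j=1}^M\prod_{i=1}^{2K}(1+x_{g_i})=\sum_\lambda\prod_{j=1}^M\prod_{i=1}^{2K}x_{g_i}^{\lambda_{j,i}}$,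 the sum running over all $M\times 2K$ matrices $\lambda$ with entries in $\{0,1\}$. The compressed operator $\tilde\rho_{\beta,M,L}$ is the part of this sum in which every column of $\lambda$ has at most $L$ ones. A PEPO of bond dimension $D$ on $G$ is an operator of the form $\sum_{\alpha:\mathcal E\to\{1,\dots,D\}}\bigotimes_{v\in\mathcal V}X^v_{\alpha(e^v_1)\dots\alpha(e^v_{z(v)})}$, where $e^v_1,\dots,e^v_{z(v)}$ are the edges at $v$ and the $X^v$ are operators on the spin at $v$; a PEPS is a vector of the same form, with the $X^v$ vectors in $\mathbb C^d$. For $\varepsilon>0$, say that $(\beta,M,L,D)$ is *$\varepsilon$-good* for $H$ (and the chosen ordering) if 1. $\bigl\|e^{-\beta H}/\operatorname{tr}e^{-\beta H}-P/\operatorname{tr}P\bigr\|_1\le\varepsilon$; 2. $e^{\beta E_0}\tilde\rho_{\beta,M,L}$ is a PEPO of bond dimension $D$ on $G$, and $\bigl\|e^{\beta E_0}\tilde\rho_{\beta,M,L}-P\bigr\|_1\le\varepsilon$; 3. for some unit vector $\psi_0$ with $P\psi_0=\psi_0$ there is a PEPS $\phi$ of bond dimension $D$ on $G$ with $\|\phi\|=1$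 and $\|\phi-\psi_0\|\le\varepsilon$; and if the ground state is unique up to a phase, this holds for every such $\psi_0$. Then: (a) There is a constant $C>0$ depending only on $d,z,\Delta,c,p,q$ such that for all such $G$, $H$, all edge orderings and all $0<\varepsilon<1$ there is an $\varepsilon$-good $(\beta,M,L,D)$ with $$0\le\beta\le C\log(N/\varepsilon),\qquad D\le e^{C\log^2(N/\varepsilon)} .$$ (b) For all $a>0$ and $k\ge0$ there is a constant $C>0$ depending only on $d,z,\Delta,c,p,q,a,k$ such that for all such $G$, $H$, all edge orderings and all $\varepsilon\ge aN^{-k}$ there is an $\varepsilon$-good $(\beta,M,L,D)$ with $$0\le\beta\le C\log N,\qquad D\le N^{C\log N} .$$ -/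

import Mathlib

noncomputable section

/-- Operators on the Hilbert space `⨂_{v ∈ V} ℂ^d` of one `d`-level spin per vertex, written as
matrices in the product basis, which is labelled by the configurations `V → Fin d`. -/
abbrev SpinOp (V : Type*) (d : ℕ) : Type _ := Matrix (V → Fin d) (V → Fin d) ℂ

/-- Vectors of the Hilbert space `⨂_{v ∈ V} ℂ^d`, with its Hilbert space norm. -/
abbrev SpinVec (V : Type*) (d : ℕ) : Type _ := EuclideanSpace ℂ (V → Fin d)

/-- `A` acts non-trivially only on the spins in `s`: it is `B ⊗ 1` with `B` an operator on the
spins in `s` and `1` the identity on the remaining spins. -/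
def SpinOp.ActsOn {V : Type*} {d : ℕ} (s : Set V) (A : SpinOp V d) : Prop :=
  ∃ B : Matrix (s → Fin d) (s → Fin d) ℂ, ∀ σ τ : V → Fin d,
    ((∀ v, v ∉ s → σ v = τ v) → A σ τ = B (fun v => σ v) (fun v => τ v)) ∧
    ((∃ v, v ∉ s ∧ σ v ≠ τ v) → A σ τ = 0)

/-- Operator norm (largest singular value). -/
def operatorNorm {ι : Type*} [Fintype ι] [DecidableEq ι] (A : Matrix ι ι ℂ) : ℝ :=
  ‖Matrix.toEuclideanCLM (𝕜 := ℂ) A‖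

/-- Trace norm `tr (A† A)^{1/2}`: the sum of the square roots of the eigenvalues of `A† A`. -/
def traceNorm {ι : Type*} [Fintype ι] [DecidableEq ι] (A : Matrix ι ι ℂ) : ℝ :=
  ∑ i, Real.sqrt ((Matrix.isHermitian_conjTranspose_mul_self A).eigenvalues i)

/-- A family of two-body interactions along the edges of `G`: each term is self-adjoint, acts
only on the two endpoints of its edge, and has operator norm at most `1`. -/
structure EdgeInteraction {V : Type*} [Fintype V] [DecidableEq V] (G : SimpleGraph V)
    (d : ℕ) where
  term : G.edgeSet → SpinOp V d
  isHermitian : ∀ e, (term e).IsHermitian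
  actsOn : ∀ e : G.edgeSet, (term e).ActsOn {v | v ∈ (e : Sym2 V)}
  norm_le_one : ∀ e, operatorNorm (term e) ≤ 1

namespace EdgeInteraction

variable {V : Type*} [Fintype V] [DecidableEq V] {G : SimpleGraph V} [DecidableRel G.Adj]
  {d : ℕ} (h : EdgeInteraction G d)

/-- The Hamiltonian `H = ∑_e h_e`. -/
def hamiltonian : SpinOp V d := ∑ e : G.edgeSet, h.term e

theorem isHermitian_hamiltonian : h.hamiltonian.IsHermitian := by
  unfold hamiltonian Matrix.IsHermitian
  rw [Matrix.conjTranspose_sum]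
  exact Finset.sum_congr rfl fun e _ => h.isHermitian e

/-- The eigenvalues of `H`, listed with multiplicity. -/
def energy (i : V → Fin d) : ℝ := h.isHermitian_hamiltonian.eigenvalues i

/-- The ground state energy, i.e. the smallest eigenvalue of `H`. -/
def groundEnergy : ℝ := ⨅ i, h.energy i

/-- The eigenspace of `H` for its smallest eigenvalue. -/
def groundSpace : Submodule ℂ (SpinVec V d) :=
  Module.End.eigenspace (Matrix.toEuclideanLin h.hamiltonian) (h.groundEnergy : ℂ)

/-- The ground state projector: the orthogonal projection onto the ground space. -/
def groundProjector : SpinOp V d :=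
  (Matrix.toEuclideanCLM (𝕜 := ℂ)).symm h.groundSpace.starProjection

/-- All eigenvalues of `H` other than the smallest one exceed it by at least `Δ`. -/
def HasGap (Δ : ℝ) : Prop :=
  ∀ i, h.energy i = h.groundEnergy ∨ h.groundEnergy + Δ ≤ h.energy i

/-- Polynomial growth of the density of states: the number of eigenvalues (with multiplicity)
at energy at most `E` above the ground state energy is at most `(c N)^(p E + q)`. -/
def PolynomialDensityOfStates (c p q : ℝ) : Prop :=
  ∀ E : ℝ, 0 ≤ E →
    (Nat.card {i // h.energy i ≤ h.groundEnergy + E} : ℝ) ≤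
      (c * (Fintype.card V : ℝ)) ^ (p * E + q)

/-- The unnormalised Gibbs operator `e^{-βH}`. -/
def boltzmann (β : ℝ) : SpinOp V d := NormedSpace.exp (-(β : ℂ) • h.hamiltonian)

/-- The Gibbs state `e^{-βH} / tr e^{-βH}`. -/
def gibbs (β : ℝ) : SpinOp V d := (h.boltzmann β).trace⁻¹ • h.boltzmann β

/-- The small operators `x_e = e^{-β h_e / 2M} - 1` of the Trotter expansion. -/
def smallOp (β : ℝ) (M : ℕ) (e : G.edgeSet) : SpinOp V d :=
  NormedSpace.exp (-((β / (2 * M) : ℝ) : ℂ) • h.term e) - 1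

/-- Given an ordering `e_1, …, e_K` of the edges, the edges in the order `e_K, …, e_1, e_1, …, e_K`
in which they occur in `τ† τ`, where `τ = ∏_i e^{-β h_{e_i} / 2M}`. -/
def column {K : ℕ} (ord : Fin K ≃ G.edgeSet) : Fin (K + K) → G.edgeSet :=
  Fin.append (fun i => ord i.rev) (fun i => ord i)

/-- The compressed Trotter operator. Expanding `(τ† τ)^M = ∏_{j=1}^M ∏_{i=1}^{2K} (1 + x_i)` gives
a sum over all `M × 2K` tables `t` of zeros and ones; only those tables are kept that contain at
most `L` ones in each of the `2K` columns. -/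
def compressedTrotter {K : ℕ} (ord : Fin K ≃ G.edgeSet) (β : ℝ) (M L : ℕ) : SpinOp V d :=
  ∑ t : Fin M → Fin (K + K) → Bool with
      (∀ i, (Finset.univ.filter fun j => t j i = true).card ≤ L),
    (List.ofFn fun j =>
      (List.ofFn fun i => if t j i = true then h.smallOp β M (column ord i) else 1).prod).prod

end EdgeInteraction

/-- `A` is a PEPO on the graph `G` with bond dimension `D`:
`A = ∑_{α : E → {1,…,D}} ⨂_v X^v_{α(e_1^v) … α(e_{z(v)}^v)}`, where `X^v` depends only on the
values of `α` on the edges at `v` and acts on the spin `v` alone. -/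
def IsPEPO {V : Type*} [Fintype V] [DecidableEq V] (G : SimpleGraph V) [DecidableRel G.Adj]
    {d : ℕ} (D : ℕ) (A : SpinOp V d) : Prop :=
  ∃ X : (v : V) → ({e : G.edgeSet // v ∈ (e : Sym2 V)} → Fin D) → Matrix (Fin d) (Fin d) ℂ,
    ∀ σ τ : V → Fin d,
      A σ τ = ∑ α : G.edgeSet → Fin D, ∏ v, X v (fun e => α e.1) (σ v) (τ v)

/-- `ψ` is a PEPS on the graph `G` with bond dimension `D`. -/
def IsPEPS {V : Type*} [Fintype V] [DecidableEq V] (G : SimpleGraph V) [DecidableRel G.Adj]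
    {d : ℕ} (D : ℕ) (ψ : SpinVec V d) : Prop :=
  ∃ X : (v : V) → ({e : G.edgeSet // v ∈ (e : Sym2 V)} → Fin D) → Fin d → ℂ,
    ∀ σ : V → Fin d,
      ψ σ = ∑ α : G.edgeSet → Fin D, ∏ v, X v (fun e => α e.1) (σ v)

/-- `ψ` is within distance `ε` of a normalised PEPS on `G` with bond dimension `D`. -/
def ApproxByPEPS {V : Type*} [Fintype V] [DecidableEq V] (G : SimpleGraph V) [DecidableRel G.Adj]
    {d : ℕ} (D : ℕ) (ε : ℝ) (ψ : SpinVec V d) : Prop :=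
  ∃ φ : SpinVec V d, IsPEPS G D φ ∧ ‖φ‖ = 1 ∧ ‖φ - ψ‖ ≤ ε

/-- The Trotter/compression construction with inverse temperature `β`, `M` Trotter steps and
cut-off `L` approximates the ground state with error `ε` and bond dimension `D`:
* the Gibbs state at `β` is `ε`-close in trace norm to the normalised ground state projector;
* the compressed Trotter operator, rescaled by `e^{β E₀}`, is a PEPO of bond dimension `D` and
  is `ε`-close in trace norm to the ground state projector;
* some ground state is `ε`-close to a PEPS of bond dimension `D`, and, if the ground state is
  unique up to a phase, it is so for every choice of the phase. -/
def EdgeInteraction.GroundStateApproximation {V : Type*} [Fintype V] [DecidableEq V]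
    {G : SimpleGraph V} [DecidableRel G.Adj] {d : ℕ} (h : EdgeInteraction G d) {K : ℕ}
    (ord : Fin K ≃ G.edgeSet) (ε β : ℝ) (M L D : ℕ) : Prop :=
  traceNorm (h.gibbs β - h.groundProjector.trace⁻¹ • h.groundProjector) ≤ ε ∧
  IsPEPO G D ((Real.exp (β * h.groundEnergy) : ℂ) • h.compressedTrotter ord β M L) ∧
  traceNorm ((Real.exp (β * h.groundEnergy) : ℂ) • h.compressedTrotter ord β M L
    - h.groundProjector) ≤ ε ∧
  (∃ ψ ∈ h.groundSpace, ‖ψ‖ = 1 ∧ ApproxByPEPS G D ε ψ) ∧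
  (Module.finrank ℂ h.groundSpace = 1 →
    ∀ ψ ∈ h.groundSpace, ‖ψ‖ = 1 → ApproxByPEPS G D ε ψ)

end

/-!
The gap and the polynomial density of states bound the excited part of the partition function,
summed over energy shells of width `Δ`; for `β` of order `log (N / ε)` it is at most `ε`, so that
both the Gibbs state and `e^{β E₀} e^{-β H}` are close to their limits.

Each of the `M` rows of the Trotter expansion is `e^{-β H / M}` times an operator close to `1` in
operator norm. By Hölder's inequality for Schatten norms, proved with the three lines theorem, the
trace norm of a product of `M` such rows is at most `tr e^{-β H}` times the product of the operator
norms of the correction factors. The tables in which some column has more than `L` ones are removed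
by inclusion–exclusion over the set of such columns, each of which costs a factor
`2 ^ (-L) e ^ {O(β)}`.

Every edge factor is a sum of `d ^ 2` product operators, so the two columns of an edge, with their
at most `L` ones labelled by such products, serve as its bond index, which takes at most
`(1 + M d²) ^ (2 L)` values. Since `M` can be taken exponential and `L` linear in `log (N / ε)`,
the bond dimension is `exp (O(log² (N / ε)))`.

The squared column norms of the error of the PEPO add up to at most `ε²`, because the
Hilbert–Schmidt norm is at most the trace norm, whereas those of the projector add up to at least
`1`. Hence some column of the PEPO is, relative to its size, close to a ground state, and its
normalization is the required PEPS.
-/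

noncomputable section

section ExpBounds

variable {𝔸 : Type*} [NormedRing 𝔸] [NormOneClass 𝔸] [NormedAlgebra ℂ 𝔸] [CompleteSpace 𝔸]

theorem norm_exp_sub_sum_le (A : 𝔸) (k : ℕ) :
    ‖NormedSpace.exp A - ∑ i ∈ Finset.range k, ((i.factorial : ℂ)⁻¹) • A ^ i‖ ≤
      Real.exp ‖A‖ - ∑ i ∈ Finset.range k, ‖A‖ ^ i / i.factorial := by
  have hexp : HasSum (fun n : ℕ => ((n.factorial : ℂ)⁻¹) • A ^ n) (NormedSpace.exp A) :=
    NormedSpace.exp_series_hasSum_exp' (𝕂 := ℂ) A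
  have hexp_norm : HasSum (fun n : ℕ => ‖A‖ ^ n / n.factorial) (Real.exp ‖A‖) := by
    rw [Real.exp_eq_exp_ℝ]
    exact NormedSpace.expSeries_div_hasSum_exp ‖A‖
  refine ((hasSum_nat_add_iff' k).2 hexp).norm_le_of_bounded
    ((hasSum_nat_add_iff' k).2 hexp_norm) fun n => ?_
  rw [norm_smul, norm_inv, Complex.norm_natCast, div_eq_inv_mul]
  gcongr
  exact norm_pow_le A _

theorem norm_exp_le_exp_norm (A : 𝔸) : ‖NormedSpace.exp A‖ ≤ Real.exp ‖A‖ := by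
  simpa using norm_exp_sub_sum_le A 0

theorem norm_exp_sub_one_le_exp_norm (A : 𝔸) : ‖NormedSpace.exp A - 1‖ ≤ Real.exp ‖A‖ - 1 := by
  simpa using norm_exp_sub_sum_le A 1

theorem norm_exp_sub_one_sub_self_le (A : 𝔸) :
    ‖NormedSpace.exp A - 1 - A‖ ≤ Real.exp ‖A‖ - 1 - ‖A‖ := by
  simpa [Finset.sum_range_succ, sub_sub] using norm_exp_sub_sum_le A 2

theorem norm_prod_exp_sub_one_sub_sum_le (l : List 𝔸) :
    ‖(l.map NormedSpace.exp).prod - 1 - l.sum‖ ≤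
      Real.exp (l.map norm).sum - 1 - (l.map norm).sum := by
  induction l with
  | nil => simp
  | cons A l ih =>
    set Q := (l.map NormedSpace.exp).prod
    set s := (l.map norm).sum
    have hsum : ‖l.sum‖ ≤ s := by simpa using norm_multiset_sum_le (l : Multiset 𝔸)
    have hexp_nonneg : 0 ≤ Real.exp ‖A‖ - 1 := by
      linarith [Real.add_one_le_exp ‖A‖, norm_nonneg A]
    have hsplit : NormedSpace.exp A * Q - 1 - (A + l.sum) =
        NormedSpace.exp A * (Q - 1 - l.sum) + (NormedSpace.exp A - 1) * l.sum
          + (NormedSpace.exp A - 1 - A) := by noncomm_ring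
    simp only [List.map_cons, List.prod_cons, List.sum_cons]
    rw [hsplit, Real.exp_add]
    calc _ ≤ ‖NormedSpace.exp A‖ * ‖Q - 1 - l.sum‖ + ‖NormedSpace.exp A - 1‖ * ‖l.sum‖
          + ‖NormedSpace.exp A - 1 - A‖ :=
            norm_add₃_le.trans (by gcongr <;> exact norm_mul_le _ _)
      _ ≤ Real.exp ‖A‖ * (Real.exp s - 1 - s) + (Real.exp ‖A‖ - 1) * s
          + (Real.exp ‖A‖ - 1 - ‖A‖) := by
            gcongr
            · exact norm_exp_le_exp_norm A
            · exact norm_exp_sub_one_le_exp_norm A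
            · exact norm_exp_sub_one_sub_self_le A
      _ = _ := by ring

theorem norm_prod_exp_sub_one_sub_sum_le_sq (l : List 𝔸) {a : ℝ}
    (hl : (l.map norm).sum ≤ a) (ha : a ≤ 1) :
    ‖(l.map NormedSpace.exp).prod - 1 - l.sum‖ ≤ a ^ 2 := by
  have hnonneg : 0 ≤ (l.map norm).sum := List.sum_nonneg (by simp)
  have hquad := Real.abs_exp_sub_one_sub_id_le (x := (l.map norm).sum)
    (by rw [abs_of_nonneg hnonneg]; exact hl.trans ha)
  calc _ ≤ _ := norm_prod_exp_sub_one_sub_sum_le l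
    _ ≤ (l.map norm).sum ^ 2 := (le_abs_self _).trans hquad
    _ ≤ a ^ 2 := by gcongr

end ExpBounds

section TraceNorm

open scoped Matrix.Norms.L2Operator InnerProductSpace

variable {ι : Type*} [Fintype ι] [DecidableEq ι]

theorem trace_eq_sum_inner_toEuclideanCLM (b : OrthonormalBasis ι ℂ (EuclideanSpace ℂ ι))
    (A : Matrix ι ι ℂ) : A.trace = ∑ i, ⟪b i, Matrix.toEuclideanCLM (𝕜 := ℂ) A (b i)⟫_ℂ := by
  rw [← A.trace_toLin_eq (PiLp.basisFun 2 ℂ ι), LinearMap.trace_eq_sum_inner _ b]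
  rfl

theorem norm_toEuclideanCLM_apply_le (A : Matrix ι ι ℂ) (x : EuclideanSpace ℂ ι) :
    ‖Matrix.toEuclideanCLM (𝕜 := ℂ) A x‖ ≤ ‖A‖ * ‖x‖ :=
  (Matrix.toEuclideanCLM (𝕜 := ℂ) A).le_opNorm x

theorem norm_trace_mul_le_sum_norm_apply (b : OrthonormalBasis ι ℂ (EuclideanSpace ℂ ι))
    (U A : Matrix ι ι ℂ) :
    ‖(U * A).trace‖ ≤ ‖U‖ * ∑ i, ‖Matrix.toEuclideanCLM (𝕜 := ℂ) A (b i)‖ := by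
  rw [trace_eq_sum_inner_toEuclideanCLM b, Finset.mul_sum]
  refine norm_sum_le_of_le _ fun i _ => (norm_inner_le_norm _ _).trans ?_
  rw [b.norm_eq_one, one_mul, map_mul]
  exact norm_toEuclideanCLM_apply_le U _

theorem norm_trace_le (A : Matrix ι ι ℂ) : ‖A.trace‖ ≤ Fintype.card ι * ‖A‖ := by
  rw [trace_eq_sum_inner_toEuclideanCLM (EuclideanSpace.basisFun ι ℂ), ← nsmul_eq_mul,
    ← Finset.card_univ]
  refine norm_sum_le_of_le _ (fun i _ => ?_) |>.trans_eq (Finset.sum_const _)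
  refine (norm_inner_le_norm _ _).trans ((mul_le_mul_of_nonneg_left
    (norm_toEuclideanCLM_apply_le _ _) (norm_nonneg _)).trans_eq ?_)
  simp

theorem traceNorm_nonneg (A : Matrix ι ι ℂ) : 0 ≤ traceNorm A :=
  Finset.sum_nonneg fun _ _ => Real.sqrt_nonneg _

theorem toEuclideanCLM_eigenvectorBasis {H : Matrix ι ι ℂ} (hH : H.IsHermitian) (i : ι) :
    Matrix.toEuclideanCLM (𝕜 := ℂ) H (hH.eigenvectorBasis i) =
      (hH.eigenvalues i : ℂ) • hH.eigenvectorBasis i :=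
  WithLp.ofLp_injective 2 <| (hH.mulVec_eigenvectorBasis i).trans (by ext; simp)

theorem norm_toEuclideanCLM_apply_sq (A : Matrix ι ι ℂ) (x : EuclideanSpace ℂ ι) :
    (‖Matrix.toEuclideanCLM (𝕜 := ℂ) A x‖ : ℂ) ^ 2 =
      ⟪x, Matrix.toEuclideanCLM (𝕜 := ℂ) (A.conjTranspose * A) x⟫_ℂ := by
  rw [← Matrix.star_eq_conjTranspose, map_mul, map_star, ContinuousLinearMap.star_eq_adjoint,
    mul_apply_eq_comp, ContinuousLinearMap.adjoint_inner_right, inner_self_eq_norm_sq_to_K]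
  rfl

theorem sqrt_eigenvalues_conjTranspose_mul_self (A : Matrix ι ι ℂ) (i : ι) :
    √((Matrix.isHermitian_conjTranspose_mul_self A).eigenvalues i) =
      ‖Matrix.toEuclideanCLM (𝕜 := ℂ) A
        ((Matrix.isHermitian_conjTranspose_mul_self A).eigenvectorBasis i)‖ := by
  have h := norm_toEuclideanCLM_apply_sq A
    ((Matrix.isHermitian_conjTranspose_mul_self A).eigenvectorBasis i)
  rw [toEuclideanCLM_eigenvectorBasis, inner_smul_right, inner_self_eq_norm_sq_to_K,
    OrthonormalBasis.norm_eq_one] at h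
  norm_num at h
  norm_cast at h
  rw [← h, Real.sqrt_sq (norm_nonneg _)]

theorem norm_trace_mul_le (U A : Matrix ι ι ℂ) : ‖(U * A).trace‖ ≤ ‖U‖ * traceNorm A :=
  (norm_trace_mul_le_sum_norm_apply _ U A).trans_eq <| congrArg _ <|
    Finset.sum_congr rfl fun i _ => (sqrt_eigenvalues_conjTranspose_mul_self A i).symm

theorem trace_cfc {H : Matrix ι ι ℂ} (hH : H.IsHermitian) (f : ℝ → ℝ) :
    (cfc f H).trace = ∑ i, (f (hH.eigenvalues i) : ℂ) := by
  rw [hH.cfc_eq, Matrix.IsHermitian.cfc, Unitary.conjStarAlgAut_apply, Matrix.trace_mul_comm,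
    ← mul_assoc]
  simp

/-- Polar decomposition: the supremum is attained at `U = (A† A)^{-1/2} A†`. -/
theorem exists_norm_le_one_trace_mul_eq_traceNorm (A : Matrix ι ι ℂ) :
    ∃ U : Matrix ι ι ℂ, ‖U‖ ≤ 1 ∧ (U * A).trace = traceNorm A := by
  set B := A.conjTranspose * A with hB
  have hBH : B.IsHermitian := Matrix.isHermitian_conjTranspose_mul_self A
  have hsa : IsSelfAdjoint B := hBH
  have hcont (f : ℝ → ℝ) : ContinuousOn f (spectrum ℝ B) :=
    Matrix.finite_real_spectrum.continuousOn f
  set S := cfc (fun x : ℝ => (√x)⁻¹) B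
  have hS : star S = S := cfc_predicate (R := ℝ) (fun x : ℝ => (√x)⁻¹) B
  have hSB : S * B = cfc (fun x : ℝ => (√x)⁻¹ * x) B := by
    rw [cfc_mul _ _ B (hcont _) (hcont _), cfc_id' ℝ B]
  refine ⟨S * A.conjTranspose, ?_, ?_⟩
  · have hsq : S * A.conjTranspose * star (S * A.conjTranspose) =
        cfc (fun x : ℝ => (√x)⁻¹ * x * (√x)⁻¹) B := by
      rw [cfc_mul _ _ B (hcont _) (hcont _), ← hSB, star_mul, hS, Matrix.star_eq_conjTranspose,
        Matrix.conjTranspose_conjTranspose, hB]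
      noncomm_ring
    rw [← abs_norm, abs_le_one_iff_mul_self_le_one, ← CStarRing.norm_self_mul_star, hsq]
    refine norm_cfc_le zero_le_one fun x _ => ?_
    rw [mul_right_comm, ← mul_inv]
    rcases lt_or_ge 0 x with hx | hx
    · rw [Real.mul_self_sqrt hx.le, inv_mul_cancel₀ hx.ne', norm_one]
    · simp [Real.sqrt_eq_zero'.2 hx]
  · rw [mul_assoc, ← hB, hSB, trace_cfc hBH, traceNorm, Complex.ofReal_sum]
    refine Finset.sum_congr rfl fun i _ => congrArg _ ?_
    rw [mul_comm, ← div_eq_mul_inv]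
    exact Real.div_sqrt

theorem traceNorm_le_of_forall {A : Matrix ι ι ℂ} {C : ℝ}
    (h : ∀ U : Matrix ι ι ℂ, ‖U‖ ≤ 1 → ‖(U * A).trace‖ ≤ C) : traceNorm A ≤ C := by
  obtain ⟨U, hU, hUA⟩ := exists_norm_le_one_trace_mul_eq_traceNorm A
  simpa [hUA, abs_of_nonneg (traceNorm_nonneg A)] using h U hU

theorem traceNorm_le_sum_norm_apply (b : OrthonormalBasis ι ℂ (EuclideanSpace ℂ ι))
    (A : Matrix ι ι ℂ) : traceNorm A ≤ ∑ i, ‖Matrix.toEuclideanCLM (𝕜 := ℂ) A (b i)‖ :=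
  traceNorm_le_of_forall fun U hU => (norm_trace_mul_le_sum_norm_apply b U A).trans
    (mul_le_of_le_one_left (by positivity) hU)

theorem norm_trace_mul_le_traceNorm {U : Matrix ι ι ℂ} (hU : ‖U‖ ≤ 1) (A : Matrix ι ι ℂ) :
    ‖(U * A).trace‖ ≤ traceNorm A :=
  (norm_trace_mul_le U A).trans (mul_le_of_le_one_left (traceNorm_nonneg A) hU)

theorem traceNorm_sum_le {κ : Type*} (s : Finset κ) (A : κ → Matrix ι ι ℂ) :
    traceNorm (∑ k ∈ s, A k) ≤ ∑ k ∈ s, traceNorm (A k) := by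
  refine traceNorm_le_of_forall fun U hU => ?_
  rw [Finset.mul_sum, Matrix.trace_sum]
  exact norm_sum_le_of_le _ fun k _ => norm_trace_mul_le_traceNorm hU (A k)

theorem traceNorm_add_le (A B : Matrix ι ι ℂ) :
    traceNorm (A + B) ≤ traceNorm A + traceNorm B := by
  simpa [Fin.sum_univ_two] using traceNorm_sum_le Finset.univ ![A, B]

theorem traceNorm_smul_le (z : ℂ) (A : Matrix ι ι ℂ) :
    traceNorm (z • A) ≤ ‖z‖ * traceNorm A := by
  refine traceNorm_le_of_forall fun U hU => ?_
  rw [mul_smul_comm, Matrix.trace_smul, norm_smul]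
  gcongr
  exact norm_trace_mul_le_traceNorm hU A

theorem norm_one_matrix_le : ‖(1 : Matrix ι ι ℂ)‖ ≤ 1 := by
  rcases isEmpty_or_nonempty ι with h | h
  · rw [Subsingleton.elim (1 : Matrix ι ι ℂ) 0]
    simp
  · exact norm_one.le

theorem norm_trace_le_traceNorm (A : Matrix ι ι ℂ) : ‖A.trace‖ ≤ traceNorm A := by
  simpa using norm_trace_mul_le_traceNorm norm_one_matrix_le A

/-- Split as `tr(A)⁻¹ ((A - B) - (tr A - tr B) tr(B)⁻¹ B)`. -/
theorem traceNorm_inv_trace_smul_sub_le {A B : Matrix ι ι ℂ} (hA : 1 ≤ ‖A.trace‖)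
    (hB : traceNorm B ≤ ‖B.trace‖) (hB0 : B.trace ≠ 0) :
    traceNorm (A.trace⁻¹ • A - B.trace⁻¹ • B) ≤ 2 * traceNorm (A - B) := by
  have hA0 : A.trace ≠ 0 := norm_pos_iff.1 (one_pos.trans_le hA)
  have hsplit : A.trace⁻¹ • A - B.trace⁻¹ • B =
      A.trace⁻¹ • ((A - B) + (-(A - B).trace * B.trace⁻¹) • B) := by
    rw [Matrix.trace_sub, smul_add, smul_sub, smul_smul]
    have : A.trace⁻¹ * (-(A.trace - B.trace) * B.trace⁻¹) = A.trace⁻¹ - B.trace⁻¹ := by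
      field_simp
      ring
    rw [this, sub_smul]
    abel
  have hsecond : traceNorm ((-(A - B).trace * B.trace⁻¹) • B) ≤ traceNorm (A - B) := by
    refine (traceNorm_smul_le _ _).trans ?_
    rw [norm_mul, norm_neg, norm_inv, mul_assoc]
    refine (mul_le_of_le_one_right (norm_nonneg _) ?_).trans (norm_trace_le_traceNorm _)
    rw [inv_mul_le_one₀ (norm_pos_iff.2 hB0)]
    exact hB
  rw [hsplit]
  calc _ ≤ ‖A.trace⁻¹‖ * (traceNorm (A - B) + traceNorm (A - B)) :=
        (traceNorm_smul_le _ _).trans (by gcongr; exact (traceNorm_add_le _ _).trans (by gcongr))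
    _ ≤ 1 * (traceNorm (A - B) + traceNorm (A - B)) := by
        have := traceNorm_nonneg (A - B)
        gcongr
        rw [norm_inv]
        exact inv_le_one_of_one_le₀ hA
    _ = _ := by ring

theorem sum_norm_sq_le_traceNorm_sq (A : Matrix ι ι ℂ) :
    ∑ i, ∑ j, ‖A i j‖ ^ 2 ≤ traceNorm A ^ 2 := by
  set hA := Matrix.isHermitian_conjTranspose_mul_self A
  have htrace : (∑ i, ∑ j, ‖A i j‖ ^ 2 : ℂ) = (A.conjTranspose * A).trace := by
    rw [Finset.sum_comm]
    simp [Matrix.trace, Matrix.mul_apply, Complex.conj_mul']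
  rw [trace_eq_sum_inner_toEuclideanCLM hA.eigenvectorBasis] at htrace
  simp only [← norm_toEuclideanCLM_apply_sq, ← sqrt_eigenvalues_conjTranspose_mul_self] at htrace
  norm_cast at htrace
  rw [htrace, traceNorm]
  exact Finset.sum_sq_le_sq_sum_of_nonneg fun i _ => Real.sqrt_nonneg _

end TraceNorm

section Hoelder

open scoped Matrix.Norms.L2Operator InnerProductSpace

variable {ι : Type*} [Fintype ι] [DecidableEq ι] {H : Matrix ι ι ℂ}

theorem exp_add_smul (H : Matrix ι ι ℂ) (z w : ℂ) :
    NormedSpace.exp ((z + w) • H) = NormedSpace.exp (z • H) * NormedSpace.exp (w • H) := by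
  rw [add_smul, Matrix.exp_add_of_commute]
  exact ((Commute.refl H).smul_left z).smul_right w

theorem exp_smul_pow (H : Matrix ι ι ℂ) (z : ℂ) (n : ℕ) :
    NormedSpace.exp (z • H) ^ n = NormedSpace.exp ((n * z) • H) := by
  rw [← Matrix.exp_nsmul, ← Nat.cast_smul_eq_nsmul ℂ, smul_smul]

theorem toEuclideanCLM_exp_apply_of_apply_eq_smul {A : Matrix ι ι ℂ} {x : EuclideanSpace ℂ ι}
    {μ : ℂ} (hx : Matrix.toEuclideanCLM (𝕜 := ℂ) A x = μ • x) :
    Matrix.toEuclideanCLM (𝕜 := ℂ) (NormedSpace.exp A) x = Complex.exp μ • x := by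
  have hpow (n : ℕ) : Matrix.toEuclideanCLM (𝕜 := ℂ) (A ^ n) x = μ ^ n • x := by
    induction n with
    | zero => simp
    | succ n ih => rw [pow_succ, map_mul, mul_apply_eq_comp, hx, map_smul, ih, smul_smul, pow_succ']
  let evalAt : Matrix ι ι ℂ →ₗ[ℂ] EuclideanSpace ℂ ι :=
    LinearMap.applyₗ x ∘ₗ (Matrix.toEuclideanLin (𝕜 := ℂ) (m := ι) (n := ι)).toLinearMap
  have hsum_exp : HasSum (fun n : ℕ => ((n.factorial : ℂ)⁻¹ • μ ^ n) • x) (Complex.exp μ • x) := by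
    rw [Complex.exp_eq_exp_ℂ]
    exact (NormedSpace.exp_series_hasSum_exp' (𝕂 := ℂ) μ).smul_const x
  refine HasSum.unique ?_ hsum_exp
  convert (NormedSpace.exp_series_hasSum_exp' (𝕂 := ℂ) A).map evalAt
    evalAt.continuous_of_finiteDimensional using 1
  · ext1 n
    rw [Function.comp_apply, map_smul, smul_assoc, ← hpow]
    rfl
  · rfl

theorem toEuclideanCLM_exp_smul_eigenvectorBasis (hH : H.IsHermitian) (z : ℂ) (i : ι) :
    Matrix.toEuclideanCLM (𝕜 := ℂ) (NormedSpace.exp (z • H)) (hH.eigenvectorBasis i) =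
      Complex.exp (z * hH.eigenvalues i) • hH.eigenvectorBasis i := by
  apply toEuclideanCLM_exp_apply_of_apply_eq_smul
  rw [map_smul, smul_apply, toEuclideanCLM_eigenvectorBasis, smul_smul]

theorem trace_exp_smul (hH : H.IsHermitian) (w : ℝ) :
    (NormedSpace.exp ((w : ℂ) • H)).trace = ∑ i, (Real.exp (w * hH.eigenvalues i) : ℂ) := by
  rw [trace_eq_sum_inner_toEuclideanCLM hH.eigenvectorBasis]
  refine Finset.sum_congr rfl fun i _ => ?_
  rw [toEuclideanCLM_exp_smul_eigenvectorBasis, inner_smul_right, inner_self_eq_norm_sq_to_K,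
    OrthonormalBasis.norm_eq_one]
  simp

theorem trace_exp_smul_re (hH : H.IsHermitian) (w : ℝ) :
    (NormedSpace.exp ((w : ℂ) • H)).trace.re = ∑ i, Real.exp (w * hH.eigenvalues i) := by
  rw [trace_exp_smul hH, ← Complex.ofReal_sum, Complex.ofReal_re]

theorem trace_exp_smul_re_nonneg (hH : H.IsHermitian) (w : ℝ) :
    0 ≤ (NormedSpace.exp ((w : ℂ) • H)).trace.re := by
  rw [trace_exp_smul_re hH]
  positivity

theorem norm_trace_exp_mul_le (hH : H.IsHermitian) (w : ℝ) (B : Matrix ι ι ℂ) :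
    ‖(NormedSpace.exp ((w : ℂ) • H) * B).trace‖ ≤
      (NormedSpace.exp ((w : ℂ) • H)).trace.re * ‖B‖ := by
  rw [Matrix.trace_mul_comm, mul_comm, trace_exp_smul_re hH]
  refine (norm_trace_mul_le_sum_norm_apply hH.eigenvectorBasis B _).trans_eq <|
    congrArg _ <| Finset.sum_congr rfl fun i _ => ?_
  rw [toEuclideanCLM_exp_smul_eigenvectorBasis, norm_smul, OrthonormalBasis.norm_eq_one, mul_one,
    ← Complex.ofReal_mul, Complex.norm_exp_ofReal]

theorem norm_exp_smul_I_le (hH : H.IsHermitian) (y : ℝ) :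
    ‖NormedSpace.exp ((y * Complex.I) • H)‖ ≤ 1 := by
  have hstar : star (NormedSpace.exp ((y * Complex.I) • H)) =
      NormedSpace.exp ((-(y * Complex.I)) • H) := by
    rw [Matrix.star_eq_conjTranspose, ← Matrix.exp_conjTranspose, Matrix.conjTranspose_smul, hH.eq]
    simp
  rw [← abs_norm, abs_le_one_iff_mul_self_le_one, ← CStarRing.norm_star_mul_self, hstar,
    ← exp_add_smul, neg_add_cancel, zero_smul, NormedSpace.exp_zero]
  exact norm_one_matrix_le

theorem norm_exp_smul_le [Nonempty ι] (hH : H.IsHermitian) (z : ℂ) :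
    ‖NormedSpace.exp (z • H)‖ ≤ Real.exp (|z.re| * ‖H‖) := by
  have hre := norm_exp_le_exp_norm ((z.re : ℂ) • H)
  rw [norm_smul, Complex.norm_real, Real.norm_eq_abs] at hre
  calc _ = ‖NormedSpace.exp ((z.re : ℂ) • H) * NormedSpace.exp ((z.im * Complex.I) • H)‖ := by
        rw [← exp_add_smul, Complex.re_add_im]
    _ ≤ Real.exp (|z.re| * ‖H‖) * 1 :=
        (norm_mul_le _ _).trans (mul_le_mul hre (norm_exp_smul_I_le hH z.im) (norm_nonneg _)
          (Real.exp_nonneg _))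
    _ = _ := mul_one _

theorem differentiable_trace_exp_mul_exp_mul (H A B : Matrix ι ι ℂ) (w : ℂ) :
    Differentiable ℂ fun z : ℂ =>
      (NormedSpace.exp (z • H) * A * NormedSpace.exp ((w - z) • H) * B).trace := by
  have hexp : Differentiable ℂ fun z : ℂ => NormedSpace.exp (z • H) := fun z =>
    (hasDerivAt_exp_smul_const H z).differentiableAt
  have hexp_sub : Differentiable ℂ fun z : ℂ => NormedSpace.exp ((w - z) • H) :=
    hexp.comp (by fun_prop : Differentiable ℂ fun z : ℂ => w - z)
  exact (LinearMap.toContinuousLinearMap (Matrix.traceLinearMap ι ℂ ℂ)).differentiable.comp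
    (((hexp.mul_const A).mul hexp_sub).mul_const B)

theorem norm_trace_exp_mul_exp_mul_le_of_re_mem_Icc [Nonempty ι] (hH : H.IsHermitian)
    (A B : Matrix ι ι ℂ) {w : ℝ} {z : ℂ} (hz : z.re ∈ Set.Icc 0 w) :
    ‖(NormedSpace.exp (z • H) * A * NormedSpace.exp ((w - z) • H) * B).trace‖ ≤
      Fintype.card ι * (Real.exp (w * ‖H‖) * ‖A‖ * Real.exp (w * ‖H‖) * ‖B‖) := by
  have hexp {u : ℂ} (hu0 : 0 ≤ u.re) (huw : u.re ≤ w) :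
      ‖NormedSpace.exp (u • H)‖ ≤ Real.exp (w * ‖H‖) := by
    refine (norm_exp_smul_le hH u).trans ?_
    rw [abs_of_nonneg hu0]
    gcongr
  refine (norm_trace_le _).trans ?_
  gcongr
  calc _ ≤ ‖NormedSpace.exp (z • H)‖ * ‖A‖ * ‖NormedSpace.exp ((w - z) • H)‖ * ‖B‖ :=
        (norm_mul_le _ _).trans (by gcongr; exact norm_mul₃_le)
    _ ≤ _ := by
        gcongr
        · exact hexp hz.1 hz.2
        · exact hexp (by simpa using hz.2) (by simpa using hz.1)

/-- Three lines theorem for `z ↦ tr (e^{zH} A e^{(w - z)H} B)`: on the lines `re z = 0` and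
`re z = w` the imaginary part only contributes unitaries. -/
theorem norm_trace_exp_mul_exp_mul_le [Nonempty ι] (hH : H.IsHermitian) (A B : Matrix ι ι ℂ)
    {v w C : ℝ} (hv : 0 ≤ v) (hw : 0 ≤ w)
    (hA : ∀ S T : Matrix ι ι ℂ, ‖S‖ ≤ 1 → ‖T‖ ≤ 1 →
      ‖(NormedSpace.exp (((v + w : ℝ) : ℂ) • H) * (S * A * T) * B).trace‖ ≤ C)
    (hB : ∀ S T : Matrix ι ι ℂ, ‖S‖ ≤ 1 → ‖T‖ ≤ 1 →
      ‖(NormedSpace.exp (((v + w : ℝ) : ℂ) • H) * (S * B * T) * A).trace‖ ≤ C) :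
    ‖(NormedSpace.exp ((v : ℂ) • H) * A * NormedSpace.exp ((w : ℂ) • H) * B).trace‖ ≤ C := by
  rcases hw.eq_or_lt with rfl | hw
  · simpa using hA 1 1 norm_one_matrix_le norm_one_matrix_le
  have hneg (y : ℝ) : ‖NormedSpace.exp ((-(y * Complex.I)) • H)‖ ≤ 1 := by
    simpa using norm_exp_smul_I_le hH (-y)
  have hstrip := PhragmenLindelof.vertical_strip (a := 0) (b := v + w) (C := C) (z := (v : ℂ))
    (differentiable_trace_exp_mul_exp_mul H A B (v + w : ℝ)).diffContOnCl ?_ ?_ ?_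
    (by simpa using hv) (by simpa using hw.le)
  · simpa using hstrip
  · refine ⟨0, by simpa using div_pos Real.pi_pos (add_pos_of_nonneg_of_pos hv hw), 0,
      Asymptotics.IsBigO.of_bound
      (Fintype.card ι * (Real.exp ((v + w) * ‖H‖) * ‖A‖ * Real.exp ((v + w) * ‖H‖) * ‖B‖)) <|
      Filter.eventually_inf_principal.2 <| .of_forall fun z hz => ?_⟩
    simpa using norm_trace_exp_mul_exp_mul_le_of_re_mem_Icc hH A B
      (Set.Ioo_subset_Icc_self (Set.mem_preimage.1 hz))
  · intro z hz
    obtain ⟨y, rfl⟩ : ∃ y : ℝ, z = y * Complex.I :=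
      ⟨z.im, by simpa [hz] using (Complex.re_add_im z).symm⟩
    rw [sub_eq_add_neg, exp_add_smul, mul_assoc (_ * A), Matrix.trace_mul_comm]
    simpa only [mul_assoc] using hB _ _ (hneg y) (norm_exp_smul_I_le hH y)
  · intro z hz
    obtain ⟨y, rfl⟩ : ∃ y : ℝ, z = (v + w : ℝ) + y * Complex.I :=
      ⟨z.im, by rw [← hz, Complex.re_add_im]⟩
    rw [exp_add_smul, sub_add_cancel_left]
    simpa only [mul_assoc] using hA _ _ (norm_exp_smul_I_le hH y) (hneg y)

theorem norm_trace_exp_mul_exp_mul_mul_le [Nonempty ι] (hH : H.IsHermitian) {W : Matrix ι ι ℂ}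
    {v w C : ℝ} (hv : 0 ≤ v) (hw : 0 ≤ w) (hC : 0 ≤ C)
    (hW : ∀ S T : Matrix ι ι ℂ,
      ‖(NormedSpace.exp (((v + w : ℝ) : ℂ) • H) * S * W * T).trace‖ ≤ C * ‖S‖ * ‖T‖)
    (A B T : Matrix ι ι ℂ) :
    ‖(NormedSpace.exp ((v : ℂ) • H) * A * (NormedSpace.exp ((w : ℂ) • H) * B * W) * T).trace‖ ≤
      C * ‖A‖ * ‖B‖ * ‖T‖ := by
  have hcontraction {S T : Matrix ι ι ℂ} (X : Matrix ι ι ℂ) (hS : ‖S‖ ≤ 1) (hT : ‖T‖ ≤ 1) :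
      ‖S * X * T‖ ≤ ‖X‖ :=
    calc _ ≤ ‖S‖ * ‖X‖ * ‖T‖ := norm_mul₃_le
      _ ≤ 1 * ‖X‖ * 1 := by gcongr
      _ = ‖X‖ := by ring
  have := norm_trace_exp_mul_exp_mul_le hH A (B * W * T) (C := C * ‖A‖ * ‖B‖ * ‖T‖) hv hw
    (fun S R hS hR => ?_) fun S R hS hR => ?_
  · simpa only [mul_assoc] using this
  · calc _ ≤ C * ‖S * A * R * B‖ * ‖T‖ := by simpa only [mul_assoc] using hW (S * A * R * B) T
      _ ≤ C * (‖A‖ * ‖B‖) * ‖T‖ := by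
          gcongr
          exact (norm_mul_le _ _).trans (by gcongr; exact hcontraction A hS hR)
      _ = _ := by ring
  · calc _ ≤ C * ‖S * B‖ * ‖T * R * A‖ := by simpa only [mul_assoc] using hW (S * B) (T * R * A)
      _ ≤ C * ‖B‖ * (‖T‖ * ‖A‖) := by
          gcongr
          · exact (norm_mul_le _ _).trans (mul_le_of_le_one_left (norm_nonneg _) hS)
          · refine (norm_mul_le _ _).trans ?_
            gcongr
            exact (norm_mul_le _ _).trans (mul_le_of_le_one_right (norm_nonneg _) hR)
      _ = _ := by ring

theorem norm_trace_exp_mul_prod_mul_le [Nonempty ι] (hH : H.IsHermitian)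
    (l : List (ℝ × Matrix ι ι ℂ)) (hl : ∀ p ∈ l, 0 ≤ p.1) {v : ℝ} (hv : 0 ≤ v)
    (S T : Matrix ι ι ℂ) :
    ‖(NormedSpace.exp ((v : ℂ) • H) * S *
        (l.map fun p => NormedSpace.exp ((p.1 : ℂ) • H) * p.2).prod * T).trace‖ ≤
      (NormedSpace.exp (((v + (l.map Prod.fst).sum : ℝ) : ℂ) • H)).trace.re *
        (l.map fun p => ‖p.2‖).prod * ‖S‖ * ‖T‖ := by
  induction l generalizing v S T with
  | nil =>
    simp only [List.map_nil, List.prod_nil, mul_one, List.sum_nil, add_zero]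
    rw [mul_assoc (NormedSpace.exp _), mul_assoc (Complex.re _)]
    refine (norm_trace_exp_mul_le hH v _).trans ?_
    have := trace_exp_smul_re_nonneg hH v
    gcongr
    exact norm_mul_le _ _
  | cons p l ih =>
    obtain ⟨w, B⟩ := p
    obtain ⟨hw, hl⟩ := List.forall_mem_cons.1 hl
    simp only [List.map_cons, List.prod_cons, List.sum_cons, ← add_assoc]
    have hZ := trace_exp_smul_re_nonneg hH (v + w + (l.map Prod.fst).sum)
    have hP : 0 ≤ (l.map fun p => ‖p.2‖).prod := List.prod_nonneg fun x hx => by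
      obtain ⟨p, -, rfl⟩ := List.mem_map.1 hx
      exact norm_nonneg _
    refine (norm_trace_exp_mul_exp_mul_mul_le hH hv hw (mul_nonneg hZ hP)
      (fun S T => ih hl (add_nonneg hv hw) S T) S B T).trans_eq ?_
    ring

/-- Hölder's inequality for Schatten norms, the factor `e^{wH}` being measured in the `M`-norm and
the `B j` in the operator norm. -/
theorem traceNorm_prod_exp_mul_le [Nonempty ι] (hH : H.IsHermitian) {w : ℝ} (hw : 0 ≤ w) {M : ℕ}
    (B : Fin M → Matrix ι ι ℂ) :
    traceNorm (List.ofFn fun j => NormedSpace.exp ((w : ℂ) • H) * B j).prod ≤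
      (NormedSpace.exp (((M * w : ℝ) : ℂ) • H)).trace.re * ∏ j, ‖B j‖ := by
  refine traceNorm_le_of_forall fun U hU => ?_
  have := norm_trace_exp_mul_prod_mul_le hH (List.ofFn fun j => (w, B j))
    (List.forall_mem_ofFn_iff.2 fun _ => hw) le_rfl U 1
  simp only [List.map_ofFn, Function.comp_def, List.sum_ofFn, List.prod_ofFn] at this
  rw [Complex.ofReal_zero, zero_smul, NormedSpace.exp_zero, one_mul, mul_one, zero_add,
    Finset.sum_const, Finset.card_univ, Fintype.card_fin, nsmul_eq_mul] at this
  refine this.trans (mul_le_of_le_one_right ?_ norm_one_matrix_le |>.trans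
    (mul_le_of_le_one_right ?_ hU))
  all_goals have := trace_exp_smul_re_nonneg hH (M * w); positivity

end Hoelder

section DensityOfStates

variable {ι : Type*} {s : Finset ι} {X Δ p q β r : ℝ}

theorem sum_pow_le_two_mul_of_card_mul_pow_le {x : ℝ} {k : ι → ℕ}
    (hk : ∀ i ∈ s, 1 ≤ k i) (hr : r ∈ Set.Icc 0 (1 / 2))
    (hcard : ∀ m, 1 ≤ m → ({i ∈ s | k i = m}.card : ℝ) * x ^ m ≤ r ^ m) :
    ∑ i ∈ s, x ^ k i ≤ 2 * r := by
  classical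
  have hmaps : ∀ i ∈ s, k i ∈ Finset.Ico 1 (s.sup k + 1) := fun i hi =>
    Finset.mem_Ico.2 ⟨hk i hi, Nat.lt_succ_of_le (Finset.le_sup hi)⟩
  calc ∑ i ∈ s, x ^ k i
      = ∑ m ∈ Finset.Ico 1 (s.sup k + 1), ({i ∈ s | k i = m}.card : ℝ) * x ^ m := by
        simp only [← Finset.sum_fiberwise_of_maps_to' hmaps, Finset.sum_const, nsmul_eq_mul]
    _ ≤ ∑ m ∈ Finset.Ico 1 (s.sup k + 1), r ^ m :=
        Finset.sum_le_sum fun m hm => hcard m (Finset.mem_Ico.1 hm).1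
    _ ≤ r ^ 1 / (1 - r) := geom_sum_Ico_le_of_lt_one hr.1 (by linarith [hr.2])
    _ ≤ 2 * r := by
        rw [pow_one, div_le_iff₀ (by linarith [hr.2])]
        nlinarith [hr.1, hr.2]

/-- The energies are sorted into shells of width `Δ`; the shell at height `m * Δ` contributes at
most `r ^ m`. -/
theorem sum_exp_neg_mul_le_two_mul {f : ι → ℝ} (hX : 1 ≤ X) (hΔ : 0 < Δ) (hp : 0 ≤ p)
    (hq : 0 ≤ q) (hβ : 0 ≤ β) (hf : ∀ i ∈ s, Δ ≤ f i)
    (hcard : ∀ E, 0 ≤ E → ({i ∈ s | f i ≤ E}.card : ℝ) ≤ X ^ (p * E + q))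
    (hr : X ^ (2 * p * Δ + q) * Real.exp (-(β * Δ)) ≤ r) (hr2 : r ≤ 1 / 2) :
    ∑ i ∈ s, Real.exp (-(β * f i)) ≤ 2 * r := by
  have hX0 : 0 < X := one_pos.trans_le hX
  set k : ι → ℕ := fun i => ⌊f i / Δ⌋₊
  have hshell {i : ι} (hi : i ∈ s) : (k i : ℝ) * Δ ≤ f i :=
    (le_div_iff₀ hΔ).1 (Nat.floor_le (div_nonneg (hΔ.le.trans (hf i hi)) hΔ.le))
  calc ∑ i ∈ s, Real.exp (-(β * f i)) ≤ ∑ i ∈ s, Real.exp (-(β * Δ)) ^ k i := by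
        gcongr with i hi
        rw [← Real.exp_nat_mul, Real.exp_le_exp]
        linarith [mul_le_mul_of_nonneg_left (hshell hi) hβ]
    _ ≤ 2 * r := by
        refine sum_pow_le_two_mul_of_card_mul_pow_le
          (fun i hi => Nat.le_floor (by simpa [one_le_div hΔ] using hf i hi))
          ⟨le_trans (by positivity) hr, hr2⟩ fun m hm => ?_
        have hcount : ({i ∈ s | k i = m}.card : ℝ) ≤ X ^ (p * (Δ * (m + 1)) + q) := by
          refine le_trans (Nat.cast_le.2 <| Finset.card_le_card <|
            Finset.monotone_filter_right s fun i _ him => ?_) (hcard _ (by positivity))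
          rw [← div_le_iff₀' hΔ, ← (show k i = m from him)]
          exact (Nat.lt_floor_add_one _).le
        have hexponent : p * (Δ * (m + 1)) + q ≤ (2 * p * Δ + q) * m := by
          have : (1 : ℝ) ≤ m := by exact_mod_cast hm
          nlinarith [mul_nonneg hp hΔ.le]
        calc _ ≤ (X ^ (2 * p * Δ + q)) ^ m * Real.exp (-(β * Δ)) ^ m := by
              rw [← Real.rpow_natCast (X ^ _), ← Real.rpow_mul hX0.le]
              gcongr
              exact hcount.trans (Real.rpow_le_rpow_of_exponent_le hX hexponent)
          _ ≤ r ^ m := by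
              rw [← mul_pow]
              gcongr

end DensityOfStates

namespace EdgeInteraction

open scoped Matrix.Norms.L2Operator

variable {V : Type*} [Fintype V] [DecidableEq V] {G : SimpleGraph V} [DecidableRel G.Adj]
  {d : ℕ} (h : EdgeInteraction G d) {Δ c p q β r : ℝ}

/-- The multiplicity of the ground state energy. -/
def degeneracy : ℕ := Finset.card {i | h.energy i = h.groundEnergy}

/-- The partition function of the excited states, with energies measured from `E₀`. -/
def excitedWeight (β : ℝ) : ℝ :=
  ∑ i with h.energy i ≠ h.groundEnergy, Real.exp (-(β * (h.energy i - h.groundEnergy)))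

theorem exists_energy_eq_groundEnergy (hd : 0 < d) : ∃ i, h.energy i = h.groundEnergy := by
  have : NeZero d := ⟨hd.ne'⟩
  exact exists_eq_ciInf_of_finite

theorem one_le_degeneracy (hd : 0 < d) : 1 ≤ h.degeneracy := by
  obtain ⟨i, hi⟩ := h.exists_energy_eq_groundEnergy hd
  exact Finset.card_pos.2 ⟨i, by simpa using hi⟩

theorem excitedWeight_nonneg (β : ℝ) : 0 ≤ h.excitedWeight β :=
  Finset.sum_nonneg fun _ _ => (Real.exp_pos _).le

variable {h}

theorem PolynomialDensityOfStates.degeneracy_le (hD : h.PolynomialDensityOfStates c p q) :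
    (h.degeneracy : ℝ) ≤ (c * Fintype.card V) ^ q := by
  have hcard := hD 0 le_rfl
  rw [mul_zero, zero_add, add_zero, Nat.card_eq_fintype_card, Fintype.card_subtype] at hcard
  exact (Nat.cast_le.2 (Finset.card_le_card
    (Finset.monotone_filter_right _ fun i _ hi => hi.le))).trans hcard

theorem PolynomialDensityOfStates.excitedWeight_le (hD : h.PolynomialDensityOfStates c p q)
    (hgap : h.HasGap Δ) (hcN : 1 ≤ c * Fintype.card V) (hΔ : 0 < Δ) (hp : 0 ≤ p) (hq : 0 ≤ q)
    (hβ : 0 ≤ β) (hr : (c * Fintype.card V) ^ (2 * p * Δ + q) * Real.exp (-(β * Δ)) ≤ r)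
    (hr2 : r ≤ 1 / 2) : h.excitedWeight β ≤ 2 * r := by
  refine sum_exp_neg_mul_le_two_mul hcN hΔ hp hq hβ (fun i hi => ?_) (fun E hE => ?_) hr hr2
  · linarith [(hgap i).resolve_left (Finset.mem_filter.1 hi).2]
  · refine le_trans (Nat.cast_le.2 ?_) (hD E hE)
    rw [Nat.card_eq_fintype_card, Fintype.card_subtype]
    refine Finset.card_le_card fun i hi => ?_
    simpa [add_comm] using (Finset.mem_filter.1 hi).2

variable (h)

theorem toEuclideanCLM_groundProjector_eigenvectorBasis (i : V → Fin d) :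
    Matrix.toEuclideanCLM (𝕜 := ℂ) h.groundProjector
        (h.isHermitian_hamiltonian.eigenvectorBasis i) =
      if h.energy i = h.groundEnergy then h.isHermitian_hamiltonian.eigenvectorBasis i else 0 := by
  have hi : h.isHermitian_hamiltonian.eigenvectorBasis i ∈
      Module.End.eigenspace (Matrix.toEuclideanLin h.hamiltonian) (h.energy i : ℂ) :=
    Module.End.mem_eigenspace_iff.2 (toEuclideanCLM_eigenvectorBasis h.isHermitian_hamiltonian i)
  rw [groundProjector, StarAlgEquiv.apply_symm_apply]
  split_ifs with hE
  · rw [hE] at hi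
    exact Submodule.starProjection_eq_self_iff.2 hi
  · refine (Submodule.starProjection_apply_eq_zero_iff _).2 fun w hw => ?_
    have hne : (h.groundEnergy : ℂ) ≠ h.energy i := by exact_mod_cast Ne.symm hE
    exact (Matrix.isSymmetric_toEuclideanLin_iff.2
      h.isHermitian_hamiltonian).orthogonalFamily_eigenspaces hne ⟨w, hw⟩ ⟨_, hi⟩

theorem trace_groundProjector : h.groundProjector.trace = h.degeneracy := by
  simp_rw [trace_eq_sum_inner_toEuclideanCLM h.isHermitian_hamiltonian.eigenvectorBasis,
    toEuclideanCLM_groundProjector_eigenvectorBasis, degeneracy]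
  simp [apply_ite]

theorem traceNorm_groundProjector_le : traceNorm h.groundProjector ≤ h.degeneracy := by
  refine (traceNorm_le_sum_norm_apply h.isHermitian_hamiltonian.eigenvectorBasis _).trans_eq ?_
  simp_rw [toEuclideanCLM_groundProjector_eigenvectorBasis, degeneracy]
  simp [apply_ite]

theorem exp_mul_trace_boltzmann (β : ℝ) :
    (Real.exp (β * h.groundEnergy) : ℂ) * (h.boltzmann β).trace =
      ((h.degeneracy + h.excitedWeight β : ℝ) : ℂ) := by
  have hsplit : ∑ i, Real.exp (β * h.groundEnergy + -β * h.energy i) =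
      h.degeneracy + h.excitedWeight β := by
    rw [← Finset.sum_filter_add_sum_filter_not Finset.univ fun i => h.energy i = h.groundEnergy]
    congr 1
    · rw [degeneracy, Finset.card_eq_sum_ones, Nat.cast_sum]
      refine Finset.sum_congr rfl fun i hi => ?_
      simp [(Finset.mem_filter.1 hi).2]
    · exact Finset.sum_congr rfl fun i _ => by ring_nf
  rw [boltzmann, ← Complex.ofReal_neg, trace_exp_smul h.isHermitian_hamiltonian, Finset.mul_sum,
    ← hsplit, Complex.ofReal_sum]
  exact Finset.sum_congr rfl fun i _ => by rw [← Complex.ofReal_mul, ← Real.exp_add, energy]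

theorem traceNorm_exp_smul_boltzmann_sub_le (β : ℝ) :
    traceNorm ((Real.exp (β * h.groundEnergy) : ℂ) • h.boltzmann β - h.groundProjector) ≤
      h.excitedWeight β := by
  refine (traceNorm_le_sum_norm_apply h.isHermitian_hamiltonian.eigenvectorBasis _).trans_eq ?_
  rw [excitedWeight, Finset.sum_filter]
  refine Finset.sum_congr rfl fun i _ => ?_
  rw [map_sub, map_smul, sub_apply, smul_apply, boltzmann,
    toEuclideanCLM_exp_smul_eigenvectorBasis, smul_smul,
    toEuclideanCLM_groundProjector_eigenvectorBasis, ← Complex.ofReal_neg, ← Complex.ofReal_mul,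
    ← Complex.ofReal_exp, ← Complex.ofReal_mul, ← Real.exp_add,
    show β * h.groundEnergy + -β * h.isHermitian_hamiltonian.eigenvalues i =
      -(β * (h.energy i - h.groundEnergy)) by rw [energy]; ring]
  by_cases hi : h.energy i = h.groundEnergy
  · simp [hi]
  · rw [if_neg hi, sub_zero, if_pos hi, norm_smul, OrthonormalBasis.norm_eq_one, mul_one,
      Complex.norm_real, Real.norm_eq_abs, Real.abs_exp]

theorem traceNorm_gibbs_sub_le (hd : 0 < d) (β : ℝ) :
    traceNorm (h.gibbs β - h.groundProjector.trace⁻¹ • h.groundProjector) ≤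
      2 * h.excitedWeight β := by
  set w : ℂ := (Real.exp (β * h.groundEnergy) : ℂ)
  have hw0 : w ≠ 0 := Complex.ofReal_ne_zero.2 (Real.exp_pos _).ne'
  have hgibbs : h.gibbs β = (w • h.boltzmann β).trace⁻¹ • w • h.boltzmann β := by
    rw [gibbs, Matrix.trace_smul, smul_smul, smul_eq_mul, mul_inv, mul_right_comm,
      inv_mul_cancel₀ hw0, one_mul]
  have hdeg : (1 : ℝ) ≤ h.degeneracy := Nat.one_le_cast.2 (h.one_le_degeneracy hd)
  have hweight := h.excitedWeight_nonneg β
  rw [hgibbs]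
  refine (traceNorm_inv_trace_smul_sub_le ?_ ?_ ?_).trans ?_
  · rw [Matrix.trace_smul, smul_eq_mul, exp_mul_trace_boltzmann, Complex.norm_real,
      Real.norm_eq_abs, abs_of_nonneg (by positivity)]
    linarith
  · rw [trace_groundProjector, Complex.norm_natCast]
    exact h.traceNorm_groundProjector_le
  · rw [trace_groundProjector]
    exact_mod_cast Nat.one_le_iff_ne_zero.1 (h.one_le_degeneracy hd)
  · gcongr
    exact h.traceNorm_exp_smul_boltzmann_sub_le β

end EdgeInteraction

section TableExpansion

theorem prod_ofFn_sum {R α : Type*} [Semiring R] {n : ℕ} (s : Fin n → Finset α)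
    (f : Fin n → α → R) :
    (List.ofFn fun i => ∑ b ∈ s i, f i b).prod =
      ∑ p ∈ Fintype.piFinset s, (List.ofFn fun i => f i (p i)).prod := by
  simpa only [MultilinearMap.mkPiAlgebraFin_apply] using
    (MultilinearMap.mkPiAlgebraFin ℕ n R).map_sum_finset f s

theorem norm_prod_ofFn_le {R : Type*} [SeminormedRing R] [NormOneClass R] {n : ℕ}
    (f : Fin n → R) : ‖(List.ofFn f).prod‖ ≤ ∏ i, ‖f i‖ := by
  simpa [List.prod_ofFn, Function.comp_def] using List.norm_prod_le (List.ofFn f)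

variable {R : Type*} [Ring R] {n M : ℕ} (x : Fin n → R)

/-- The term `∏ j, ∏ i, x i ^ (t j i)` of the expansion of `(∏ i, (1 + x i)) ^ M`. -/
def tableProduct (t : Fin M → Fin n → Bool) : R :=
  (List.ofFn fun j => (List.ofFn fun i => if t j i = true then x i else 1).prod).prod

/-- The rows in which column `i` of the table `t` has a one. -/
def columnSupport (t : Fin M → Fin n → Bool) (i : Fin n) : Finset (Fin M) :=
  {j | t j i = true}

/-- The product `∏ i, (1 + x i)` in which the factors with index in `S` are expanded and the term
`x i` is selected from those with `i ∈ J`, the term `1` from the others. -/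
def partialRow (S J : Finset (Fin n)) : R :=
  (List.ofFn fun i => if i ∈ S then (if i ∈ J then x i else 1) else 1 + x i).prod

/-- The sum of the terms of the expansion of `(∏ i, (1 + x i)) ^ M` whose table has the column
`c i` at each index `i ∈ S`. -/
def partialProduct (S : Finset (Fin n)) (c : Fin n → Finset (Fin M)) : R :=
  (List.ofFn fun j => partialRow x S {i | j ∈ c i}).prod

/-- The columns with more than `L` ones, prescribed at the indices in `S` only. -/
def heavyColumns (M L : ℕ) (S : Finset (Fin n)) : Finset (Fin n → Finset (Fin M)) :=
  Fintype.piFinset fun i => if i ∈ S then Finset.univ.filter (L < ·.card) else {∅}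

theorem partialProduct_eq_sum (S : Finset (Fin n)) (c : Fin n → Finset (Fin M)) :
    partialProduct x S c = ∑ t with (∀ i ∈ S, columnSupport t i = c i), tableProduct x t := by
  let cell (j : Fin M) (i : Fin n) : Finset Bool :=
    if i ∈ S then {decide (j ∈ c i)} else Finset.univ
  have hrow (j : Fin M) : partialRow x S {i | j ∈ c i} =
      ∑ τ ∈ Fintype.piFinset (cell j),
        (List.ofFn fun i => if τ i = true then x i else 1).prod := by
    rw [← prod_ofFn_sum (cell j) fun i b => if b = true then x i else 1, partialRow]
    congr 2 with i
    by_cases hi : i ∈ S <;> simp [cell, hi, add_comm]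
  simp only [partialProduct, hrow]
  rw [prod_ofFn_sum (fun j => Fintype.piFinset (cell j))
    fun _ τ => (List.ofFn fun i => if τ i = true then x i else 1).prod]
  refine Finset.sum_congr (Finset.ext fun t => ?_) fun _ _ => rfl
  simp only [Fintype.mem_piFinset, Finset.mem_filter, Finset.mem_univ, true_and]
  rw [forall_comm]
  refine forall_congr' fun i => ?_
  by_cases hi : i ∈ S
  · simp only [cell, hi, if_true, Finset.mem_singleton, columnSupport, Finset.ext_iff,
      Finset.mem_filter, Finset.mem_univ, true_and, forall_const]
    exact forall_congr' fun j => by rw [Bool.eq_iff_iff, decide_eq_true_iff]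
  · simp [cell, hi]

theorem sum_partialProduct_heavyColumns (L : ℕ) (S : Finset (Fin n)) :
    ∑ c ∈ heavyColumns M L S, partialProduct x S c =
      ∑ t : Fin M → Fin n → Bool with (∀ i ∈ S, L < (columnSupport t i).card),
        tableProduct x t := by
  let key (t : Fin M → Fin n → Bool) (i : Fin n) : Finset (Fin M) :=
    if i ∈ S then columnSupport t i else ∅
  rw [← Finset.sum_fiberwise_of_maps_to (g := key) (t := heavyColumns M L S)]
  · refine Finset.sum_congr rfl fun c hc => ?_
    rw [partialProduct_eq_sum, Finset.filter_filter]
    refine Finset.sum_congr (Finset.filter_congr fun t _ => ?_) fun _ _ => rfl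
    simp only [heavyColumns, Fintype.mem_piFinset] at hc
    have hkey : key t = c ↔ ∀ i ∈ S, columnSupport t i = c i := by
      refine funext_iff.trans (forall_congr' fun i => ?_)
      specialize hc i
      by_cases hi : i ∈ S
      · simp [key, hi]
      · simpa [key, hi, eq_comm] using hc
    rw [hkey, iff_and_self]
    intro ht i hi
    simpa [hi, ht i hi] using hc i
  · intro t ht
    simp only [heavyColumns, Fintype.mem_piFinset]
    intro i
    by_cases hi : i ∈ S
    · simpa [key, hi] using (Finset.mem_filter.1 ht).2 i hi
    · simp [key, hi]

theorem sum_heavyColumns_empty (M L : ℕ) :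
    ∑ c ∈ heavyColumns M L ∅, partialProduct x ∅ c = partialRow x ∅ ∅ ^ M := by
  have hcolumns : heavyColumns M L (∅ : Finset (Fin n)) = {fun _ => ∅} := by
    simp [heavyColumns, Fintype.piFinset_singleton]
  simp [hcolumns, partialProduct]

/-- Inclusion–exclusion over the set of columns with more than `L` ones. -/
theorem sum_tableProduct_card_le (L : ℕ) :
    ∑ t : Fin M → Fin n → Bool with (∀ i, (columnSupport t i).card ≤ L), tableProduct x t =
      ∑ S : Finset (Fin n), (-1 : ℤ) ^ S.card •
        ∑ c ∈ heavyColumns M L S, partialProduct x S c := by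
  have hsieve := Finset.inclusion_exclusion_sum_inf_compl Finset.univ
    (fun i : Fin n => Finset.univ.filter fun t : Fin M → Fin n → Bool =>
      L < (columnSupport t i).card) (tableProduct x)
  rw [Finset.powerset_univ] at hsieve
  convert hsieve using 2 with S
  · ext t
    simp [Finset.mem_inf]
  · rw [sum_partialProduct_heavyColumns]
    congr 2 with t
    simp [Finset.mem_inf]

theorem sum_pow_card_le {y : ℝ} (hy : 0 ≤ y) (M L : ℕ) :
    ∑ c : Finset (Fin M) with L < c.card, y ^ c.card ≤ (1 / 2) ^ L * (1 + 2 * y) ^ M := by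
  have hbinomial := Fintype.sum_pow_mul_eq_add_pow (Fin M) (2 * y) 1
  simp only [one_pow, mul_one, Fintype.card_fin] at hbinomial
  rw [add_comm, ← hbinomial, Finset.mul_sum, Finset.sum_filter]
  refine Finset.sum_le_sum fun c _ => ?_
  split_ifs with hc
  · rw [mul_pow, ← mul_assoc]
    refine le_mul_of_one_le_left (by positivity) ?_
    rw [one_div, inv_pow, inv_mul_eq_div, one_le_div (by positivity)]
    exact pow_le_pow_right₀ one_le_two hc.le
  · positivity

theorem sum_heavyColumns_le {y : ℝ} (hy : 0 ≤ y) (M L : ℕ) (S : Finset (Fin n)) :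
    ∑ c ∈ heavyColumns M L S, ∏ j, ∏ i ∈ S, (if j ∈ c i then y else 1) ≤
      ((1 / 2) ^ L * (1 + 2 * y) ^ M) ^ S.card := by
  have hcolumns (c : Fin n → Finset (Fin M)) :
      ∏ j, ∏ i ∈ S, (if j ∈ c i then y else 1) = ∏ i, if i ∈ S then y ^ (c i).card else 1 := by
    rw [Finset.prod_comm, Finset.prod_ite_mem, Finset.univ_inter]
    simp [Finset.prod_ite_mem]
  simp only [hcolumns, heavyColumns]
  rw [← Finset.prod_univ_sum _ fun i (c : Finset (Fin M)) => if i ∈ S then y ^ c.card else 1,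
    ← Finset.prod_const, ← Finset.prod_subset (Finset.subset_univ S) (by simp +contextual)]
  refine Finset.prod_le_prod (fun i hi => ?_) fun i hi => ?_
  · simp only [hi, if_true]
    positivity
  · simpa [hi] using sum_pow_card_le hy M L

end TableExpansion

section TrotterRow

variable {𝔸 : Type*} [NormedRing 𝔸] [NormedAlgebra ℂ 𝔸] {n : ℕ} {A : Fin n → 𝔸} {s : ℝ}

/-- The small operator `e ^ (-s A) - 1` of the Trotter expansion. -/
def trotterFactor (s : ℝ) (B : 𝔸) : 𝔸 := NormedSpace.exp (-(s : ℂ) • B) - 1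

theorem norm_neg_ofReal_smul_le (hs : 0 ≤ s) {B : 𝔸} (hB : ‖B‖ ≤ 1) : ‖-(s : ℂ) • B‖ ≤ s := by
  rw [norm_smul, norm_neg, Complex.norm_real, Real.norm_of_nonneg hs]
  exact mul_le_of_le_one_right hs hB

theorem norm_smul_sum_le (hs : 0 ≤ s) (hA : ∀ i, ‖A i‖ ≤ 1) :
    ‖(s : ℂ) • ∑ i, A i‖ ≤ s * n := by
  rw [norm_smul, Complex.norm_real, Real.norm_of_nonneg hs]
  gcongr
  simpa using norm_sum_le_of_le Finset.univ fun i _ => hA i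

variable [NormOneClass 𝔸] [CompleteSpace 𝔸]

theorem norm_trotterFactor_le (hs : s ∈ Set.Icc 0 1) {B : 𝔸} (hB : ‖B‖ ≤ 1) :
    ‖trotterFactor s B‖ ≤ 2 * s := by
  have hexp := Real.abs_exp_sub_one_le (x := s) (by rw [abs_of_nonneg hs.1]; exact hs.2)
  rw [abs_of_nonneg hs.1] at hexp
  calc _ ≤ Real.exp ‖-(s : ℂ) • B‖ - 1 := norm_exp_sub_one_le_exp_norm _
    _ ≤ Real.exp s - 1 := by
        gcongr
        exact norm_neg_ofReal_smul_le hs.1 hB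
    _ ≤ 2 * s := (le_abs_self _).trans hexp

/-- The generators of the factors add up to `s • ∑ i ∈ S, A i`, so the linear term of the product
is small and the rest is of second order. -/
theorem norm_exp_mul_partialRow_empty_sub_one_le (hs : 0 ≤ s) (hsn : 2 * s * n ≤ 1)
    (hA : ∀ i, ‖A i‖ ≤ 1) (S : Finset (Fin n)) :
    ‖NormedSpace.exp ((s : ℂ) • ∑ i, A i) * partialRow (fun i => trotterFactor s (A i)) S ∅ - 1‖ ≤
      s * S.card + (2 * s * n) ^ 2 := by
  set B : Fin n → 𝔸 := fun i => if i ∈ S then 0 else -(s : ℂ) • A i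
  set l : List 𝔸 := ((s : ℂ) • ∑ i, A i) :: List.ofFn B
  have hprod : NormedSpace.exp ((s : ℂ) • ∑ i, A i) *
      partialRow (fun i => trotterFactor s (A i)) S ∅ = (l.map NormedSpace.exp).prod := by
    rw [List.map_cons, List.prod_cons, List.map_ofFn, partialRow]
    congr 3 with i
    by_cases hi : i ∈ S <;> simp [B, hi, trotterFactor]
  have hB (i : Fin n) : ‖B i‖ ≤ s := by
    by_cases hi : i ∈ S
    · simpa [B, hi] using hs
    · simpa only [B, if_neg hi] using norm_neg_ofReal_smul_le hs (hA i)
  have hnorm : (l.map norm).sum ≤ 2 * s * n := by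
    rw [List.map_cons, List.sum_cons, List.map_ofFn, List.sum_ofFn]
    have hsumB : ∑ i, ‖B i‖ ≤ n * s := by
      simpa using Finset.sum_le_card_nsmul Finset.univ (fun i => ‖B i‖) s fun i _ => hB i
    simp only [Function.comp_apply]
    linarith [norm_smul_sum_le hs hA]
  have hsum : l.sum = ∑ i ∈ S, (s : ℂ) • A i := by
    rw [List.sum_cons, List.sum_ofFn, Finset.smul_sum, ← Finset.sum_add_distrib,
      ← Finset.sum_subset (Finset.subset_univ S) fun i _ hi => by simp [B, hi]]
    exact Finset.sum_congr rfl fun i hi => by simp [B, hi]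
  have hnorm_sum : ‖l.sum‖ ≤ s * S.card := by
    rw [hsum, mul_comm, ← nsmul_eq_mul, ← Finset.sum_const]
    exact norm_sum_le_of_le _ fun i _ => by
      simpa only [neg_smul, norm_neg] using norm_neg_ofReal_smul_le hs (hA i)
  rw [hprod]
  calc _ = ‖l.sum + ((l.map NormedSpace.exp).prod - 1 - l.sum)‖ := by rw [add_sub_cancel]
    _ ≤ _ := norm_add_le_of_le hnorm_sum (norm_prod_exp_sub_one_sub_sum_le_sq l hnorm hsn)

theorem norm_partialRow_le (hs : s ∈ Set.Icc 0 1) (hA : ∀ i, ‖A i‖ ≤ 1) (S J : Finset (Fin n)) :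
    ‖partialRow (fun i => trotterFactor s (A i)) S J‖ ≤
      Real.exp (s * n) * ∏ i ∈ S, if i ∈ J then 2 * s else 1 := by
  have hfactor (i : Fin n) :
      ‖if i ∈ S then (if i ∈ J then trotterFactor s (A i) else 1) else 1 + trotterFactor s (A i)‖ ≤
        Real.exp s * if i ∈ S then (if i ∈ J then 2 * s else 1) else 1 := by
    have hexp : 1 ≤ Real.exp s := Real.one_le_exp hs.1
    split_ifs
    · exact (norm_trotterFactor_le hs (hA i)).trans
        (le_mul_of_one_le_left (mul_nonneg zero_le_two hs.1) hexp)
    · simpa using hexp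
    · rw [trotterFactor, add_sub_cancel, mul_one]
      exact (norm_exp_le_exp_norm _).trans
        (Real.exp_le_exp.2 (norm_neg_ofReal_smul_le hs.1 (hA i)))
  refine (norm_prod_ofFn_le _).trans
    ((Finset.prod_le_prod (fun i _ => norm_nonneg _) fun i _ => hfactor i).trans_eq ?_)
  rw [Finset.prod_mul_distrib, Finset.prod_const, Finset.card_univ, Fintype.card_fin,
    ← Real.exp_nat_mul, mul_comm (n : ℝ), Finset.prod_ite_mem, Finset.univ_inter]

/-- One small factor pays for the crude bound `e ^ (2 s n) ≤ 3` on all the other factors. -/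
theorem norm_exp_mul_partialRow_le_of_mem (hs : 0 ≤ s) (hsn : 2 * s * n ≤ 1)
    (hA : ∀ i, ‖A i‖ ≤ 1) {S J : Finset (Fin n)} {k : Fin n} (hkS : k ∈ S) (hkJ : k ∈ J) :
    ‖NormedSpace.exp ((s : ℂ) • ∑ i, A i) * partialRow (fun i => trotterFactor s (A i)) S J‖ ≤
      ∏ i ∈ S, if i ∈ J then 6 * s else 1 := by
  have hn : (1 : ℝ) ≤ n := by exact_mod_cast Fin.pos k
  have hnonneg (T : Finset (Fin n)) : 0 ≤ ∏ i ∈ T, if i ∈ J then 2 * s else 1 :=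
    Finset.prod_nonneg fun i _ => by split_ifs <;> positivity
  have hexp : Real.exp (s * n) * Real.exp (s * n) ≤ 3 := by
    rw [← Real.exp_add]
    exact (Real.exp_le_exp.2 (by linarith)).trans Real.exp_one_lt_three.le
  calc _ ≤ Real.exp (s * n) * (Real.exp (s * n) * ∏ i ∈ S, if i ∈ J then 2 * s else 1) :=
        (norm_mul_le _ _).trans <| mul_le_mul ((norm_exp_le_exp_norm _).trans
            (Real.exp_le_exp.2 (norm_smul_sum_le hs hA)))
          (norm_partialRow_le ⟨hs, by nlinarith⟩ hA S J) (norm_nonneg _) (Real.exp_pos _).le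
    _ ≤ 3 * ∏ i ∈ S, if i ∈ J then 2 * s else 1 := by
        rw [← mul_assoc]
        exact mul_le_mul_of_nonneg_right hexp (hnonneg S)
    _ = 6 * s * ∏ i ∈ S.erase k, if i ∈ J then 2 * s else 1 := by
        rw [← Finset.mul_prod_erase S _ hkS, if_pos hkJ]
        ring
    _ ≤ 6 * s * ∏ i ∈ S.erase k, if i ∈ J then 6 * s else 1 := by
        refine mul_le_mul_of_nonneg_left (Finset.prod_le_prod (fun i _ => ?_) fun i _ => ?_)
          (by positivity) <;> split_ifs <;> linarith
    _ = ∏ i ∈ S, if i ∈ J then 6 * s else 1 := by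
        rw [← Finset.mul_prod_erase S _ hkS, if_pos hkJ]

theorem norm_exp_mul_partialRow_le (hs : 0 ≤ s) (hsn : 2 * s * n ≤ 1) (hA : ∀ i, ‖A i‖ ≤ 1)
    (S J : Finset (Fin n)) :
    ‖NormedSpace.exp ((s : ℂ) • ∑ i, A i) * partialRow (fun i => trotterFactor s (A i)) S J‖ ≤
      Real.exp (s * S.card + (2 * s * n) ^ 2) * ∏ i ∈ S, if i ∈ J then 6 * s else 1 := by
  by_cases hJ : ∃ k ∈ S, k ∈ J
  · obtain ⟨k, hkS, hkJ⟩ := hJ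
    refine (norm_exp_mul_partialRow_le_of_mem hs hsn hA hkS hkJ).trans
      (le_mul_of_one_le_left (Finset.prod_nonneg fun i _ => ?_) (Real.one_le_exp (by positivity)))
    split_ifs <;> positivity
  · push Not at hJ
    have hrow : partialRow (fun i => trotterFactor s (A i)) S J =
        partialRow (fun i => trotterFactor s (A i)) S ∅ := by
      rw [partialRow, partialRow]
      congr 2 with i
      by_cases hi : i ∈ S <;> simp [hi, hJ]
    rw [hrow, Finset.prod_eq_one fun i hi => if_neg (hJ i hi), mul_one,
      ← sub_add_cancel (NormedSpace.exp _ * _) 1]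
    exact (norm_add_le_of_le (norm_exp_mul_partialRow_empty_sub_one_le hs hsn hA S)
      norm_one.le).trans (Real.add_one_le_exp _)

end TrotterRow

section CompressionBounds

open scoped Matrix.Norms.L2Operator

variable {ι : Type*} [Fintype ι] [DecidableEq ι]

theorem exp_smul_neg_mul_exp_smul_mul (s : ℝ) (G X : Matrix ι ι ℂ) :
    NormedSpace.exp ((s : ℂ) • -G) * (NormedSpace.exp ((s : ℂ) • G) * X) = X := by
  rw [← mul_assoc, smul_neg, ← neg_smul, ← exp_add_smul, neg_add_cancel, zero_smul,
    NormedSpace.exp_zero, one_mul]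

variable [Nonempty ι]

/-- Expand `B = 1 + (B - 1)` in each of the factors. -/
theorem traceNorm_exp_mul_pow_sub_le {H : Matrix ι ι ℂ} (hH : H.IsHermitian) {w : ℝ} (hw : 0 ≤ w)
    (M : ℕ) (B : Matrix ι ι ℂ) :
    traceNorm ((NormedSpace.exp ((w : ℂ) • H) * B) ^ M -
        NormedSpace.exp (((M * w : ℝ) : ℂ) • H)) ≤
      (NormedSpace.exp (((M * w : ℝ) : ℂ) • H)).trace.re * ((1 + ‖B - 1‖) ^ M - 1) := by
  classical
  set R := NormedSpace.exp ((w : ℂ) • H)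
  let D (b : Bool) : Matrix ι ι ℂ := if b = true then B - 1 else 1
  have := trace_exp_smul_re_nonneg hH (M * w)
  have hR : NormedSpace.exp (((M * w : ℝ) : ℂ) • H) = R ^ M := by
    push_cast
    exact (exp_smul_pow H w M).symm
  have hpow : (R * B) ^ M = ∑ p : Fin M → Bool, (List.ofFn fun j => R * D (p j)).prod := by
    have hexpand := prod_ofFn_sum (fun _ : Fin M => Finset.univ) fun _ b => R * D b
    rw [Fintype.piFinset_univ] at hexpand
    rw [← hexpand, List.ofFn_const, List.prod_replicate, Fintype.sum_bool, ← mul_add]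
    simp [D]
  have hsub : (R * B) ^ M - NormedSpace.exp (((M * w : ℝ) : ℂ) • H) =
      ∑ p ∈ Finset.univ.erase fun _ : Fin M => false, (List.ofFn fun j => R * D (p j)).prod := by
    rw [hpow, ← Finset.add_sum_erase _ _ (Finset.mem_univ fun _ : Fin M => false), hR]
    simp [D]
  have hD (b : Bool) : ‖D b‖ = if b = true then ‖B - 1‖ else 1 := by
    cases b <;> simp [D]
  have hbinomial : ∑ p ∈ Finset.univ.erase fun _ : Fin M => false, ∏ j, ‖D (p j)‖ =
      (1 + ‖B - 1‖) ^ M - 1 := by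
    have hexpand := Finset.prod_univ_sum (fun _ : Fin M => Finset.univ) fun _ b => ‖D b‖
    rw [Fintype.piFinset_univ, ← Finset.add_sum_erase _ _ (Finset.mem_univ fun _ => false)]
      at hexpand
    simp only [hD, Fintype.sum_bool, Finset.prod_const, Finset.card_univ, Fintype.card_fin,
      if_true, Bool.false_eq_true, if_false, one_pow] at hexpand ⊢
    rw [add_comm 1 ‖B - 1‖, hexpand, add_sub_cancel_left]
  rw [hsub, ← hbinomial, Finset.mul_sum]
  exact (traceNorm_sum_le _ _).trans
    (Finset.sum_le_sum fun p _ => traceNorm_prod_exp_mul_le hH hw fun j => D (p j))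

variable {n M : ℕ} {A : Fin n → Matrix ι ι ℂ} {s : ℝ}

theorem traceNorm_partialProduct_le (hG : (∑ i, A i).IsHermitian) (hs : 0 ≤ s)
    (hsn : 2 * s * n ≤ 1) (hA : ∀ i, ‖A i‖ ≤ 1) (S : Finset (Fin n))
    (c : Fin n → Finset (Fin M)) :
    traceNorm (partialProduct (fun i => trotterFactor s (A i)) S c) ≤
      (NormedSpace.exp (((M * s : ℝ) : ℂ) • -∑ i, A i)).trace.re *
        (Real.exp (s * S.card + (2 * s * n) ^ 2) ^ M *
          ∏ j, ∏ i ∈ S, if j ∈ c i then 6 * s else 1) := by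
  set x : Fin n → Matrix ι ι ℂ := fun i => trotterFactor s (A i)
  have hfactors : partialProduct x S c = (List.ofFn fun j =>
      NormedSpace.exp ((s : ℂ) • -∑ i, A i) *
        (NormedSpace.exp ((s : ℂ) • ∑ i, A i) * partialRow x S {i | j ∈ c i})).prod := by
    simp only [exp_smul_neg_mul_exp_smul_mul, partialProduct]
  rw [hfactors]
  refine (traceNorm_prod_exp_mul_le hG.neg hs _).trans
    (mul_le_mul_of_nonneg_left ?_ (trace_exp_smul_re_nonneg hG.neg _))
  refine (Finset.prod_le_prod (fun j _ => norm_nonneg _) fun j _ =>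
    norm_exp_mul_partialRow_le hs hsn hA S {i | j ∈ c i}).trans_eq ?_
  simp [Finset.prod_mul_distrib]

theorem exp_pow_mul_tail_pow_le (hs : 0 ≤ s) (M L k : ℕ) (r : ℝ) :
    Real.exp (s * k + r) ^ M * ((1 / 2) ^ L * (1 + 2 * (6 * s)) ^ M) ^ k ≤
      Real.exp (M * r) * ((1 / 2) ^ L * Real.exp (13 * (s * M))) ^ k := by
  have hexp : (1 + 2 * (6 * s)) ^ M ≤ Real.exp (12 * (s * M)) := by
    calc _ ≤ Real.exp (12 * s) ^ M := by
          gcongr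
          linarith [Real.add_one_le_exp (12 * s)]
      _ = _ := by rw [← Real.exp_nat_mul]; ring_nf
  have hsplit : Real.exp (s * k + r) ^ M = Real.exp (M * r) * Real.exp (s * M) ^ k := by
    simp only [← Real.exp_nat_mul, ← Real.exp_add]
    ring_nf
  rw [hsplit, mul_assoc, ← mul_pow]
  refine mul_le_mul_of_nonneg_left (pow_le_pow_left₀ (by positivity) ?_ k) (Real.exp_pos _).le
  calc _ ≤ Real.exp (s * M) * ((1 / 2) ^ L * Real.exp (12 * (s * M))) := by gcongr
    _ = (1 / 2) ^ L * Real.exp (s * M + 12 * (s * M)) := by rw [Real.exp_add]; ring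
    _ = _ := by ring_nf

theorem traceNorm_sum_heavyColumns_le (hG : (∑ i, A i).IsHermitian) (hs : 0 ≤ s)
    (hsn : 2 * s * n ≤ 1) (hA : ∀ i, ‖A i‖ ≤ 1) (L : ℕ) (S : Finset (Fin n)) :
    traceNorm (∑ c ∈ heavyColumns M L S, partialProduct (fun i => trotterFactor s (A i)) S c) ≤
      (NormedSpace.exp (((M * s : ℝ) : ℂ) • -∑ i, A i)).trace.re *
        (Real.exp (M * (2 * s * n) ^ 2) * ((1 / 2) ^ L * Real.exp (13 * (s * M))) ^ S.card) := by
  refine ((traceNorm_sum_le _ _).trans (Finset.sum_le_sum fun c _ =>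
    traceNorm_partialProduct_le hG hs hsn hA S c)).trans ?_
  rw [← Finset.mul_sum, ← Finset.mul_sum]
  refine mul_le_mul_of_nonneg_left ?_ (trace_exp_smul_re_nonneg hG.neg _)
  refine le_trans ?_ (exp_pow_mul_tail_pow_le hs M L S.card ((2 * s * n) ^ 2))
  gcongr
  exact sum_heavyColumns_le (by positivity) M L S

theorem traceNorm_partialRow_empty_pow_sub_le (hG : (∑ i, A i).IsHermitian) (hs : 0 ≤ s)
    (hsn : 2 * s * n ≤ 1) (hA : ∀ i, ‖A i‖ ≤ 1) :
    traceNorm (partialRow (fun i => trotterFactor s (A i)) ∅ ∅ ^ M -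
        NormedSpace.exp (((M * s : ℝ) : ℂ) • -∑ i, A i)) ≤
      (NormedSpace.exp (((M * s : ℝ) : ℂ) • -∑ i, A i)).trace.re *
        (Real.exp (M * (2 * s * n) ^ 2) - 1) := by
  have hB := norm_exp_mul_partialRow_empty_sub_one_le hs hsn hA ∅
  set B := NormedSpace.exp ((s : ℂ) • ∑ i, A i) *
    partialRow (fun i => trotterFactor s (A i)) ∅ ∅ with hBdef
  rw [Finset.card_empty, Nat.cast_zero, mul_zero, zero_add] at hB
  rw [← exp_smul_neg_mul_exp_smul_mul (s := s) (∑ i, A i) (partialRow _ ∅ ∅), ← hBdef]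
  refine (traceNorm_exp_mul_pow_sub_le hG.neg hs M B).trans
    (mul_le_mul_of_nonneg_left ?_ (trace_exp_smul_re_nonneg hG.neg _))
  rw [Real.exp_nat_mul]
  gcongr
  linarith [Real.add_one_le_exp ((2 * s * n) ^ 2)]

theorem sum_erase_empty_pow_card (n : ℕ) (θ : ℝ) :
    ∑ S ∈ Finset.univ.erase (∅ : Finset (Fin n)), θ ^ S.card = (1 + θ) ^ n - 1 := by
  have hbinomial := Fintype.sum_pow_mul_eq_add_pow (Fin n) θ 1
  rw [← Finset.add_sum_erase _ _ (Finset.mem_univ ∅)] at hbinomial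
  simp only [one_pow, mul_one, Finset.card_empty, pow_zero, Fintype.card_fin] at hbinomial
  rw [add_comm 1 θ, ← hbinomial, add_sub_cancel_left]

theorem traceNorm_sum_tableProduct_sub_exp_le (hG : (∑ i, A i).IsHermitian) (hs : 0 ≤ s)
    (hsn : 2 * s * n ≤ 1) (hA : ∀ i, ‖A i‖ ≤ 1) (M L : ℕ) :
    traceNorm (∑ t : Fin M → Fin n → Bool with (∀ i, (columnSupport t i).card ≤ L),
        tableProduct (fun i => trotterFactor s (A i)) t -
        NormedSpace.exp (((M * s : ℝ) : ℂ) • -∑ i, A i)) ≤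
      (NormedSpace.exp (((M * s : ℝ) : ℂ) • -∑ i, A i)).trace.re *
        (Real.exp (M * (2 * s * n) ^ 2 + n * ((1 / 2) ^ L * Real.exp (13 * (s * M)))) - 1) := by
  set Z := (NormedSpace.exp (((M * s : ℝ) : ℂ) • -∑ i, A i)).trace.re
  set θ := (1 / 2 : ℝ) ^ L * Real.exp (13 * (s * M))
  set x : Fin n → Matrix ι ι ℂ := fun i => trotterFactor s (A i)
  have hZ : 0 ≤ Z := trace_exp_smul_re_nonneg hG.neg _
  have hterm (S : Finset (Fin n)) :
      traceNorm ((-1 : ℤ) ^ S.card • ∑ c ∈ heavyColumns M L S, partialProduct x S c) ≤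
        Z * (Real.exp (M * (2 * s * n) ^ 2) * θ ^ S.card) := by
    have hsign := traceNorm_smul_le ((-1 : ℂ) ^ S.card)
      (∑ c ∈ heavyColumns M L S, partialProduct x S c)
    rw [norm_pow, norm_neg, norm_one, one_pow, one_mul] at hsign
    rw [← Int.cast_smul_eq_zsmul ℂ]
    push_cast
    exact hsign.trans (traceNorm_sum_heavyColumns_le hG hs hsn hA L S)
  rw [sum_tableProduct_card_le, ← Finset.add_sum_erase _ _ (Finset.mem_univ ∅),
    sum_heavyColumns_empty, Finset.card_empty, pow_zero, one_smul, add_sub_right_comm]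
  calc _ ≤ Z * (Real.exp (M * (2 * s * n) ^ 2) - 1) +
        ∑ S ∈ Finset.univ.erase ∅, Z * (Real.exp (M * (2 * s * n) ^ 2) * θ ^ S.card) :=
        (traceNorm_add_le _ _).trans <| add_le_add
          (traceNorm_partialRow_empty_pow_sub_le hG hs hsn hA)
          ((traceNorm_sum_le _ _).trans (Finset.sum_le_sum fun S _ => hterm S))
    _ = Z * (Real.exp (M * (2 * s * n) ^ 2) * (1 + θ) ^ n - 1) := by
        rw [← Finset.mul_sum, ← Finset.mul_sum, sum_erase_empty_pow_card]
        ring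
    _ ≤ Z * (Real.exp (M * (2 * s * n) ^ 2 + n * θ) - 1) := by
        rw [Real.exp_add, Real.exp_nat_mul θ]
        gcongr
        linarith [Real.add_one_le_exp θ]

end CompressionBounds

namespace EdgeInteraction

variable {V : Type*} [Fintype V] [DecidableEq V] {G : SimpleGraph V} [DecidableRel G.Adj]
  {d : ℕ} (h : EdgeInteraction G d) {K : ℕ} (ord : Fin K ≃ G.edgeSet)

theorem sum_term_column : ∑ i, h.term (column ord i) = (2 : ℂ) • h.hamiltonian := by
  have hforward : ∑ i, h.term (ord i) = h.hamiltonian := Equiv.sum_comp ord h.term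
  have hbackward : ∑ i : Fin K, h.term (ord i.rev) = h.hamiltonian :=
    Equiv.sum_comp (Fin.revPerm.trans ord) h.term
  rw [Fin.sum_univ_add]
  simp only [column, Fin.append_left, Fin.append_right]
  rw [hforward, hbackward, two_smul]

theorem traceNorm_compressedTrotter_sub_boltzmann_le (hd : 0 < d) {β : ℝ} (hβ : 0 ≤ β) {M : ℕ}
    (hM : 0 < M) (hMβ : 2 * β * K ≤ M) (L : ℕ) :
    traceNorm (h.compressedTrotter ord β M L - h.boltzmann β) ≤
      (h.boltzmann β).trace.re *
        (Real.exp (4 * β ^ 2 * K ^ 2 / M + 2 * K * ((1 / 2) ^ L * Real.exp (7 * β))) - 1) := by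
  have : Nonempty (Fin d) := ⟨⟨0, hd⟩⟩
  have hM0 : (0 : ℝ) < M := by exact_mod_cast hM
  have hboltzmann : NormedSpace.exp (((M * (β / (2 * M)) : ℝ) : ℂ) •
      -∑ i, h.term (column ord i)) = h.boltzmann β := by
    rw [sum_term_column, boltzmann, smul_neg, neg_smul, smul_smul]
    congr 3
    have : (M : ℂ) ≠ 0 := by exact_mod_cast hM.ne'
    push_cast
    field_simp
  have hbound := traceNorm_sum_tableProduct_sub_exp_le (s := β / (2 * M))
    (by rw [sum_term_column, two_smul]
        exact h.isHermitian_hamiltonian.add h.isHermitian_hamiltonian)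
    (by positivity) (by push_cast; field_simp; linarith)
    (fun i => h.norm_le_one (column ord i)) M L
  rw [hboltzmann] at hbound
  have hZ : 0 ≤ (h.boltzmann β).trace.re := by
    simpa [boltzmann] using trace_exp_smul_re_nonneg h.isHermitian_hamiltonian (-β)
  refine hbound.trans (mul_le_mul_of_nonneg_left (sub_le_sub_right (Real.exp_le_exp.2
    (add_le_add ?_ ?_)) _) hZ)
  · push_cast
    field_simp
    linarith
  · have hexponent : 13 * (β / (2 * M) * M) ≤ 7 * β := by
      field_simp
      linarith
    rw [Nat.cast_add, ← two_mul]
    gcongr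

theorem traceNorm_rescaled_compressedTrotter_sub_le (hd : 0 < d) {β : ℝ} (hβ : 0 ≤ β) {M : ℕ}
    (hM : 0 < M) (hMβ : 2 * β * K ≤ M) (L : ℕ) :
    traceNorm ((Real.exp (β * h.groundEnergy) : ℂ) • h.compressedTrotter ord β M L -
        h.groundProjector) ≤
      (h.degeneracy + h.excitedWeight β) *
        (Real.exp (4 * β ^ 2 * K ^ 2 / M + 2 * K * ((1 / 2) ^ L * Real.exp (7 * β))) - 1) +
      h.excitedWeight β := by
  set E : ℂ := (Real.exp (β * h.groundEnergy) : ℂ) with hE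
  have hpartition : Real.exp (β * h.groundEnergy) * (h.boltzmann β).trace.re =
      h.degeneracy + h.excitedWeight β := by
    simpa [← Complex.ofReal_exp] using congr_arg Complex.re (h.exp_mul_trace_boltzmann β)
  rw [show E • h.compressedTrotter ord β M L - h.groundProjector =
      E • (h.compressedTrotter ord β M L - h.boltzmann β) +
        (E • h.boltzmann β - h.groundProjector) by rw [smul_sub, sub_add_sub_cancel]]
  refine (traceNorm_add_le _ _).trans
    (add_le_add ((traceNorm_smul_le _ _).trans ?_) (h.traceNorm_exp_smul_boltzmann_sub_le β))
  rw [hE, Complex.norm_real, Real.norm_of_nonneg (Real.exp_pos _).le, ← hpartition, mul_assoc]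
  gcongr
  exact h.traceNorm_compressedTrotter_sub_boltzmann_le ord hd hβ hM hMβ L

end EdgeInteraction

section LocalOperators

open scoped Matrix.Norms.L2Operator Kronecker

variable {V : Type*} [Fintype V] [DecidableEq V] {d : ℕ}

section Embedding

variable (s : Set V) [DecidablePred (· ∈ s)]

/-- The embedding `B ↦ B ⊗ 1` of the operators on the spins in `s` into those on all spins. -/
def localEmbedding : Matrix (s → Fin d) (s → Fin d) ℂ →+* SpinOp V d where
  toFun B := (B ⊗ₖ (1 : Matrix ({v // v ∉ s} → Fin d) ({v // v ∉ s} → Fin d) ℂ)).submatrix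
    (Equiv.piEquivPiSubtypeProd (· ∈ s) fun _ => Fin d)
    (Equiv.piEquivPiSubtypeProd (· ∈ s) fun _ => Fin d)
  map_one' := by rw [Matrix.one_kronecker_one]; exact Matrix.submatrix_one_equiv _
  map_mul' B C := by
    rw [Matrix.submatrix_mul_equiv, ← Matrix.mul_kronecker_mul, mul_one]
  map_zero' := by rw [Matrix.zero_kronecker]; rfl
  map_add' B C := by rw [Matrix.add_kronecker]; rfl

theorem localEmbedding_apply (B : Matrix (s → Fin d) (s → Fin d) ℂ) (σ τ : V → Fin d) :
    localEmbedding s B σ τ =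
      if ∀ v, v ∉ s → σ v = τ v then B (fun v => σ v) (fun v => τ v) else 0 := by
  change B (fun v => σ v) (fun v => τ v) *
    (1 : Matrix ({v // v ∉ s} → Fin d) ({v // v ∉ s} → Fin d) ℂ) (fun v => σ v) (fun v => τ v) = _
  simp only [Matrix.one_apply, funext_iff, Subtype.forall, mul_ite, mul_one, mul_zero]

theorem continuous_localEmbedding : Continuous (localEmbedding (d := d) s) := by
  refine continuous_pi fun σ => continuous_pi fun τ => ?_
  simp_rw [localEmbedding_apply]
  split_ifs
  · exact (continuous_apply _).comp (continuous_apply _)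
  · exact continuous_const

theorem localEmbedding_smul (c : ℂ) (B : Matrix (s → Fin d) (s → Fin d) ℂ) :
    localEmbedding s (c • B) = c • localEmbedding s B := by
  ext σ τ
  simp only [localEmbedding_apply, Matrix.smul_apply, smul_ite, smul_zero]

end Embedding

theorem SpinOp.actsOn_iff {s : Set V} [DecidablePred (· ∈ s)] {A : SpinOp V d} :
    A.ActsOn s ↔ ∃ B, localEmbedding s B = A := by
  refine exists_congr fun B => ⟨fun hB => ?_, ?_⟩
  · ext σ τ
    rw [localEmbedding_apply]
    split_ifs with hστ
    · exact ((hB σ τ).1 hστ).symm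
    · push Not at hστ
      exact ((hB σ τ).2 hστ).symm
  · rintro rfl σ τ
    rw [localEmbedding_apply]
    exact ⟨fun hστ => if_pos hστ, fun ⟨v, hv, hne⟩ => if_neg fun hστ => hne (hστ v hv)⟩

theorem SpinOp.ActsOn.trotterFactor {s : Set V} {A : SpinOp V d} (hA : A.ActsOn s) (r : ℝ) :
    SpinOp.ActsOn s (trotterFactor r A) := by
  classical
  obtain ⟨B, rfl⟩ := SpinOp.actsOn_iff.1 hA
  refine SpinOp.actsOn_iff.2 ⟨_root_.trotterFactor r B, ?_⟩
  let _ : NormedAlgebra ℚ (Matrix (s → Fin d) (s → Fin d) ℂ) := .restrictScalars ℚ ℂ _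
  let _ : NormedAlgebra ℚ (SpinOp V d) := .restrictScalars ℚ ℂ _
  rw [_root_.trotterFactor, _root_.trotterFactor, map_sub, map_one,
    NormedSpace.map_exp _ (continuous_localEmbedding s), localEmbedding_smul]

end LocalOperators

section ProductOperators

variable {V : Type*} [DecidableEq V] {d : ℕ}

/-- The product operators `|i⟩⟨j|_u ⊗ B_{ij}`, where `B_{ij}` is the block of `B` at the entry
`(i, j)` of the spin `u`. -/
def twoBodyFactor (u v : V) (B : Matrix ({w | w ∈ s(u, v)} → Fin d) ({w | w ∈ s(u, v)} → Fin d) ℂ)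
    (a : Fin d × Fin d) (w : V) : Matrix (Fin d) (Fin d) ℂ :=
  if w = u then Matrix.single a.1 a.2 1
  else if w = v then Matrix.of fun m m' =>
    B (fun w => if (w : V) = u then a.1 else m) (fun w => if (w : V) = u then a.2 else m')
  else 1

theorem sum_twoBodyFactor_mul {u v : V} (huv : u ≠ v)
    (B : Matrix ({w | w ∈ s(u, v)} → Fin d) ({w | w ∈ s(u, v)} → Fin d) ℂ) (σ τ : V → Fin d) :
    ∑ a, twoBodyFactor u v B a u (σ u) (τ u) * twoBodyFactor u v B a v (σ v) (τ v) =
      B (fun w => σ w) (fun w => τ w) := by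
  have hrestrict (ρ : V → Fin d) :
      (fun w : {w | w ∈ s(u, v)} => if (w : V) = u then ρ u else ρ v) =
        fun w : {w | w ∈ s(u, v)} => ρ w := by
    funext ⟨w, hw⟩
    rcases Sym2.mem_iff.1 hw with rfl | rfl
    · simp
    · simp [huv.symm]
  rw [Finset.sum_eq_single (σ u, τ u)]
  · rw [← hrestrict σ, ← hrestrict τ]
    simp [twoBodyFactor, huv.symm]
  · intro a _ ha
    have hsingle : twoBodyFactor u v B a u (σ u) (τ u) = 0 := by
      rw [twoBodyFactor, if_pos rfl, Matrix.single_apply, if_neg]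
      exact fun hστ => ha (Prod.ext hστ.1 hστ.2)
    rw [hsingle, zero_mul]
  · exact fun hmem => absurd (Finset.mem_univ _) hmem

variable [Fintype V]

/-- The product operator `⨂_v Y_v`. -/
def productOp : (V → Matrix (Fin d) (Fin d) ℂ) →* SpinOp V d where
  toFun Y := Matrix.of fun σ τ => ∏ v, Y v (σ v) (τ v)
  map_one' := by
    ext σ τ
    simp only [Matrix.of_apply, Pi.one_apply, Matrix.one_apply, Finset.prod_ite_zero,
      Finset.prod_const_one, Finset.mem_univ, true_imp_iff, funext_iff]
  map_mul' Y Z := by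
    ext σ τ
    simp only [Matrix.of_apply, Pi.mul_apply, Matrix.mul_apply]
    rw [Finset.prod_univ_sum, Fintype.piFinset_univ]
    exact Finset.sum_congr rfl fun ρ _ => Finset.prod_mul_distrib

theorem productOp_apply (Y : V → Matrix (Fin d) (Fin d) ℂ) (σ τ : V → Fin d) :
    productOp Y σ τ = ∏ v, Y v (σ v) (τ v) := rfl

theorem productOp_eq_ite {u v : V} (huv : u ≠ v) {Y : V → Matrix (Fin d) (Fin d) ℂ}
    (hY : ∀ w, w ∉ s(u, v) → Y w = 1) (σ τ : V → Fin d) :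
    productOp Y σ τ =
      if ∀ w, w ∉ s(u, v) → σ w = τ w then Y u (σ u) (τ u) * Y v (σ v) (τ v) else 0 := by
  have hrest : ∏ w ∈ (Finset.univ.erase u).erase v, Y w (σ w) (τ w) =
      if ∀ w, w ∉ s(u, v) → σ w = τ w then 1 else 0 := by
    have hdelta : ∀ w ∈ (Finset.univ.erase u).erase v,
        Y w (σ w) (τ w) = if σ w = τ w then 1 else 0 := fun w hw => by
      rw [hY w (by simpa [and_comm] using hw), Matrix.one_apply]
    rw [Finset.prod_congr rfl hdelta, Finset.prod_ite_zero, Finset.prod_const_one]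
    simp only [Finset.mem_erase, Finset.mem_univ, and_true, Sym2.mem_iff, not_or,
      and_comm (a := _ ≠ v), ne_eq]
  rw [productOp_apply, ← Finset.mul_prod_erase _ _ (Finset.mem_univ u),
    ← Finset.mul_prod_erase _ _ (Finset.mem_erase.2 ⟨huv.symm, Finset.mem_univ v⟩), hrest,
    mul_ite, mul_ite, mul_one, mul_zero, mul_zero]

theorem SpinOp.ActsOn.exists_eq_sum_productOp {u v : V} (huv : u ≠ v) {A : SpinOp V d}
    (hA : A.ActsOn {w | w ∈ s(u, v)}) :
    ∃ Y : Fin d × Fin d → V → Matrix (Fin d) (Fin d) ℂ,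
      (∀ a w, w ∉ s(u, v) → Y a w = 1) ∧ A = ∑ a, productOp (Y a) := by
  obtain ⟨B, hB⟩ := hA
  have hY (a : Fin d × Fin d) (w : V) (hw : w ∉ s(u, v)) : twoBodyFactor u v B a w = 1 := by
    rw [Sym2.mem_iff, not_or] at hw
    rw [twoBodyFactor, if_neg hw.1, if_neg hw.2]
  refine ⟨twoBodyFactor u v B, hY, ?_⟩
  ext σ τ
  rw [Matrix.sum_apply, Finset.sum_congr rfl fun a _ => productOp_eq_ite huv (hY a) σ τ]
  split_ifs with hστ
  · rw [(hB σ τ).1 hστ, sum_twoBodyFactor_mul huv]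
  · push Not at hστ
    rw [(hB σ τ).2 hστ, Finset.sum_const_zero]

end ProductOperators

section TensorNetworks

variable {V : Type*} [Fintype V] [DecidableEq V] {G : SimpleGraph V} [DecidableRel G.Adj] {d : ℕ}

theorem IsPEPO.of_fintype {I : Type*} [Fintype I] {A : SpinOp V d}
    (X : (v : V) → ({e : G.edgeSet // v ∈ (e : Sym2 V)} → I) → Matrix (Fin d) (Fin d) ℂ)
    (hA : A = ∑ α : G.edgeSet → I, productOp fun v => X v fun e => α e.1) :
    IsPEPO G (Fintype.card I) A := by
  refine ⟨fun v a => X v fun e => (Fintype.equivFin I).symm (a e), fun σ τ => ?_⟩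
  rw [hA, Matrix.sum_apply]
  exact (Equiv.sum_comp (Equiv.arrowCongr (Equiv.refl _) (Fintype.equivFin I).symm)
    fun α : G.edgeSet → I => productOp (fun v => X v fun e => α e.1) σ τ).symm

/-- Absorb the scalar into the tensor at one vertex. -/
theorem IsPEPO.smul [Nonempty V] {D : ℕ} {A : SpinOp V d} (hA : IsPEPO G D A) (c : ℂ) :
    IsPEPO G D (c • A) := by
  obtain ⟨X, hX⟩ := hA
  obtain ⟨v₀⟩ := ‹Nonempty V›
  refine ⟨fun v a => (if v = v₀ then c else 1) • X v a, fun σ τ => ?_⟩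
  rw [Matrix.smul_apply, hX, smul_eq_mul, Finset.mul_sum]
  refine Finset.sum_congr rfl fun α _ => ?_
  simp_rw [Matrix.smul_apply, smul_eq_mul]
  rw [Finset.prod_mul_distrib, Fintype.prod_ite_eq']

theorem IsPEPS.smul [Nonempty V] {D : ℕ} {ψ : SpinVec V d} (hψ : IsPEPS G D ψ) (c : ℂ) :
    IsPEPS G D (c • ψ) := by
  obtain ⟨X, hX⟩ := hψ
  obtain ⟨v₀⟩ := ‹Nonempty V›
  refine ⟨fun v a i => (if v = v₀ then c else 1) * X v a i, fun σ => ?_⟩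
  rw [PiLp.smul_apply, hX, smul_eq_mul, Finset.mul_sum]
  refine Finset.sum_congr rfl fun α _ => ?_
  rw [Finset.prod_mul_distrib, Fintype.prod_ite_eq']

theorem IsPEPO.isPEPS_col {D : ℕ} {A : SpinOp V d} (hA : IsPEPO G D A) (τ : V → Fin d) :
    IsPEPS G D (WithLp.toLp 2 fun σ => A σ τ) := by
  obtain ⟨X, hX⟩ := hA
  exact ⟨fun v a i => X v a i (τ v), fun σ => hX σ τ⟩

end TensorNetworks

section SparseColumns

/-- Columns of length `M` that carry a label from `O` in at most `L` places. -/
abbrev SparseColumn (M L : ℕ) (O : Type*) : Type _ :=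
  {g : Fin M → Option O // (Finset.univ.filter fun j => (g j).isSome = true).card ≤ L}

variable {M L : ℕ} {O : Type*}

instance SparseColumn.instInhabited : Inhabited (SparseColumn M L O) :=
  ⟨fun _ => none, by simp⟩

theorem SparseColumn.exists_eq_update (g : SparseColumn M (L + 1) O) :
    ∃ (g' : SparseColumn M L O) (x : Option (Fin M × O)),
      g.1 = x.elim g'.1 fun y => Function.update g'.1 y.1 (some y.2) := by
  obtain ⟨g, hg⟩ := g
  rcases Nat.lt_or_ge L (Finset.univ.filter fun j => (g j).isSome = true).card with hL | hL
  · obtain ⟨j, hj⟩ := Finset.card_pos.1 (Nat.zero_lt_of_lt hL)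
    obtain ⟨o, ho⟩ := Option.isSome_iff_exists.1 (Finset.mem_filter.1 hj).2
    refine ⟨⟨Function.update g j none, ?_⟩, some (j, o), by simp [← ho]⟩
    have herase : (Finset.univ.filter fun i => (Function.update g j none i).isSome = true) =
        (Finset.univ.filter fun i => (g i).isSome = true).erase j := by
      ext i
      by_cases hij : i = j <;> simp [hij]
    rw [herase, Finset.card_erase_of_mem hj]
    exact Nat.sub_le_of_le_add hg
  · exact ⟨⟨g, hL⟩, none, rfl⟩

variable [Fintype O]

theorem card_sparseColumn_le :
    Fintype.card (SparseColumn M L O) ≤ (1 + M * Fintype.card O) ^ L := by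
  induction L with
  | zero =>
    refine Fintype.card_le_one_iff.2 fun g g' => Subtype.ext (funext fun j => ?_)
    have hnone (g : SparseColumn M 0 O) : g.1 j = none := by
      have hempty := Finset.card_eq_zero.1 (Nat.le_zero.1 g.2)
      simpa using Finset.filter_eq_empty_iff.1 hempty (Finset.mem_univ j)
    rw [hnone, hnone]
  | succ L ih =>
    choose g' x hx using SparseColumn.exists_eq_update (M := M) (L := L) (O := O)
    have hinj : Function.Injective fun g => (g' g, x g) := fun g₁ g₂ h => by
      obtain ⟨hg, hxx⟩ := Prod.mk.inj h
      exact Subtype.ext (by rw [hx g₁, hx g₂, hg, hxx])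
    refine (Fintype.card_le_of_injective _ hinj).trans ?_
    rw [Fintype.card_prod, Fintype.card_option, Fintype.card_prod, Fintype.card_fin, pow_succ,
      add_comm (M * _)]
    exact Nat.mul_le_mul_right _ ih

theorem sum_sparse_eq_sum_sparseColumn {n : ℕ} {B : Type*} [AddCommMonoid B]
    (Φ : (Fin M → Fin n → Option O) → B) :
    ∑ f with (∀ i, (Finset.univ.filter fun j => (f j i).isSome = true).card ≤ L), Φ f =
      ∑ g : Fin n → SparseColumn M L O, Φ fun j i => (g i).1 j := by
  rw [← Finset.sum_subtype_eq_sum_filter, Finset.subtype_univ]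
  let e : (Fin n → SparseColumn M L O) ≃ {f : Fin M → Fin n → Option O //
      ∀ i, (Finset.univ.filter fun j => (f j i).isSome = true).card ≤ L} :=
    { toFun := fun g => ⟨fun j i => (g i).1 j, fun i => (g i).2⟩
      invFun := fun f i => ⟨fun j => f.1 j i, f.2 i⟩ }
  exact (e.sum_comp fun f => Φ f).symm

end SparseColumns

section LabelledTables

variable {M n : ℕ} {O : Type*}

/-- The product of the operators `x i a` selected by a table of labels `a`, in which an empty cell
contributes a factor `1`. -/
def labelledTableProduct {R : Type*} [Monoid R] (x : Fin n → O → R)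
    (f : Fin M → Fin n → Option O) : R :=
  (List.ofFn fun j => (List.ofFn fun i => (f j i).elim 1 (x i)).prod).prod

theorem map_labelledTableProduct {R S : Type*} [Monoid R] [Monoid S] (φ : R →* S)
    (x : Fin n → O → R) (f : Fin M → Fin n → Option O) :
    φ (labelledTableProduct x f) = labelledTableProduct (fun i a => φ (x i a)) f := by
  have hcell (j : Fin M) (i : Fin n) :
      φ ((f j i).elim 1 (x i)) = (f j i).elim 1 fun a => φ (x i a) := by
    cases f j i <;> simp
  simp only [labelledTableProduct, map_list_prod, List.map_ofFn, Function.comp_def, hcell]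

variable {R : Type*} [Ring R] [Fintype O]

theorem tableProduct_sum (x : Fin n → O → R) (t : Fin M → Fin n → Bool) :
    tableProduct (fun i => ∑ a, x i a) t =
      ∑ f : Fin M → Fin n → Option O with (fun j i => (f j i).isSome) = t,
        labelledTableProduct x f := by
  have hcell (j : Fin M) (i : Fin n) : (if t j i = true then ∑ a, x i a else 1) =
      ∑ o : Option O with o.isSome = t j i, o.elim 1 (x i) := by
    rw [Finset.sum_filter, Fintype.sum_option]
    cases t j i <;> simp
  simp_rw [tableProduct, hcell, prod_ofFn_sum, labelledTableProduct]
  refine Finset.sum_congr (Finset.ext fun f => ?_) fun _ _ => rfl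
  simp [Fintype.mem_piFinset, funext_iff]

theorem sum_tableProduct_sum (x : Fin n → O → R) (L : ℕ) :
    ∑ t : Fin M → Fin n → Bool with (∀ i, (columnSupport t i).card ≤ L),
        tableProduct (fun i => ∑ a, x i a) t =
      ∑ g : Fin n → SparseColumn M L O, labelledTableProduct x fun j i => (g i).1 j := by
  classical
  let sparse : Finset (Fin M → Fin n → Option O) :=
    {f | ∀ i, (Finset.univ.filter fun j => (f j i).isSome = true).card ≤ L}
  have hmaps : ∀ f ∈ sparse, (fun j i => (f j i).isSome) ∈
      (Finset.univ.filter fun t : Fin M → Fin n → Bool => ∀ i, (columnSupport t i).card ≤ L) :=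
    fun f hf => Finset.mem_filter.2 ⟨Finset.mem_univ _, (Finset.mem_filter.1 hf).2⟩
  rw [← sum_sparse_eq_sum_sparseColumn fun f => labelledTableProduct x f,
    ← Finset.sum_fiberwise_of_maps_to hmaps]
  refine Finset.sum_congr rfl fun t ht => ?_
  rw [tableProduct_sum, Finset.filter_filter]
  refine Finset.sum_congr (Finset.filter_congr fun f _ => ?_) fun _ _ => rfl
  refine ⟨?_, And.right⟩
  rintro rfl
  exact ⟨(Finset.mem_filter.1 ht).2, rfl⟩

end LabelledTables

namespace EdgeInteraction

variable {V : Type*} {G : SimpleGraph V} {K : ℕ} (ord : Fin K ≃ G.edgeSet)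

/-- Every edge owns two of the `2 K` columns, so a family indexed by the columns is a family of
pairs indexed by the edges. -/
def pairedColumns (S : Type*) : (G.edgeSet → S × S) ≃ (Fin (K + K) → S) :=
  (Equiv.arrowProdEquivProdArrow G.edgeSet (fun _ => S) fun _ => S).trans <|
    (Equiv.sumArrowEquivProdArrow _ _ _).symm.trans <|
    Equiv.arrowCongr (finSumFinEquiv.symm.trans
      (Equiv.sumCongr (Fin.revPerm.trans ord) ord)).symm (Equiv.refl S)

theorem pairedColumns_congr {S : Type*} {α α' : G.edgeSet → S × S} {i : Fin (K + K)}
    (hα : α (column ord i) = α' (column ord i)) :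
    pairedColumns ord S α i = pairedColumns ord S α' i := by
  have happly (γ : G.edgeSet → S × S) : pairedColumns ord S γ i =
      Fin.addCases (motive := fun _ => S) (fun i => (γ (ord i.rev)).1)
        (fun i => (γ (ord i)).2) i := by
    induction i using Fin.addCases with
    | left i => simp [pairedColumns]
    | right i => simp [pairedColumns, -Fin.natAdd_eq_addNat]
  rw [happly, happly]
  induction i using Fin.addCases with
  | left i => simp_all [column]
  | right i => simp_all [column, -Fin.natAdd_eq_addNat]

variable [Fintype V] [DecidableEq V] {d : ℕ} (h : EdgeInteraction G d)

theorem exists_smallOp_eq_sum (β : ℝ) (M : ℕ) (e : G.edgeSet) :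
    ∃ Y : Fin d × Fin d → V → Matrix (Fin d) (Fin d) ℂ,
      (∀ a w, w ∉ (e : Sym2 V) → Y a w = 1) ∧ h.smallOp β M e = ∑ a, productOp (Y a) := by
  obtain ⟨⟨u, v⟩, he⟩ := e
  exact ((h.actsOn ⟨s(u, v), he⟩).trotterFactor _).exists_eq_sum_productOp (G.ne_of_adj he)

variable [DecidableRel G.Adj]

theorem compressedTrotter_eq_sum_productOp (β : ℝ) (M L : ℕ)
    {Y : G.edgeSet → Fin d × Fin d → V → Matrix (Fin d) (Fin d) ℂ}
    (hY : ∀ e, h.smallOp β M e = ∑ a, productOp (Y e a)) :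
    h.compressedTrotter ord β M L =
      ∑ α : G.edgeSet → SparseColumn M L (Fin d × Fin d) × SparseColumn M L (Fin d × Fin d),
        productOp (labelledTableProduct (fun i => Y (column ord i))
          fun j i => (pairedColumns ord _ α i).1 j) := by
  change ∑ t with (∀ i, (columnSupport t i).card ≤ L),
    tableProduct (fun i => h.smallOp β M (column ord i)) t = _
  simp only [hY]
  rw [sum_tableProduct_sum, ← (pairedColumns ord _).sum_comp]
  simp only [map_labelledTableProduct]

/-- The number of values of the pair of labelled columns that belongs to one edge. -/
def bondDim (d M L : ℕ) : ℕ :=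
  Fintype.card (SparseColumn M L (Fin d × Fin d) × SparseColumn M L (Fin d × Fin d))

theorem bondDim_le (d M L : ℕ) : bondDim d M L ≤ (1 + M * d ^ 2) ^ (2 * L) := by
  have hcard := card_sparseColumn_le (M := M) (L := L) (O := Fin d × Fin d)
  rw [Fintype.card_prod, Fintype.card_fin, ← sq] at hcard
  rw [bondDim, Fintype.card_prod, two_mul, pow_add]
  exact Nat.mul_le_mul hcard hcard

/-- The columns that belong to the edge `e` are the bond index at `e`: at a vertex `v` the factors
of the edges that do not contain `v` are trivial, so these columns may be replaced by `default`. -/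
theorem isPEPO_compressedTrotter (β : ℝ) (M L : ℕ) :
    IsPEPO G (bondDim d M L) (h.compressedTrotter ord β M L) := by
  choose Y hY_one hY using h.exists_smallOp_eq_sum β M
  refine IsPEPO.of_fintype (fun v a => labelledTableProduct (fun i b => Y (column ord i) b v)
    fun j i => (pairedColumns ord _
      (fun e => if hv : v ∈ (e : Sym2 V) then a ⟨e, hv⟩ else default) i).1 j) ?_
  rw [h.compressedTrotter_eq_sum_productOp ord β M L hY]
  refine Finset.sum_congr rfl fun α _ => congrArg productOp (funext fun v => ?_)
  refine (map_labelledTableProduct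
    (Pi.evalMonoidHom (fun _ : V => Matrix (Fin d) (Fin d) ℂ) v) _ _).trans ?_
  simp only [labelledTableProduct, Pi.evalMonoidHom_apply]
  congr! 6 with j i
  by_cases hv : v ∈ (column ord i : Sym2 V)
  · rw [pairedColumns_congr ord]
    simp [hv]
  · have hone : (fun b => Y (column ord i) b v) = fun _ => 1 := funext fun b => hY_one _ _ _ hv
    have helim (o : Option (Fin d × Fin d)) :
        o.elim (1 : Matrix (Fin d) (Fin d) ℂ) (fun _ => 1) = 1 := by cases o <;> rfl
    rw [hone, helim, helim]

end EdgeInteraction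

section Normalization

variable {ι E : Type*} [Fintype ι] [NormedAddCommGroup E] {δ : ℝ}

theorem exists_norm_sub_le_mul_norm {x p : ι → E} (hδ : 0 ≤ δ)
    (hxp : ∑ i, ‖x i - p i‖ ^ 2 ≤ δ ^ 2) (hp : 1 ≤ ∑ i, ‖p i‖ ^ 2) :
    ∃ i, p i ≠ 0 ∧ ‖x i - p i‖ ≤ δ * ‖p i‖ := by
  by_contra! hlt
  obtain ⟨i₀, -, hi₀⟩ := Finset.exists_ne_zero_of_sum_ne_zero (zero_lt_one.trans_le hp).ne'
  have hsq (i : ι) (hi : p i ≠ 0) : (δ * ‖p i‖) ^ 2 < ‖x i - p i‖ ^ 2 :=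
    pow_lt_pow_left₀ (hlt i hi) (by positivity) two_ne_zero
  have hsum : ∑ i, (δ * ‖p i‖) ^ 2 < ∑ i, ‖x i - p i‖ ^ 2 := by
    refine Finset.sum_lt_sum (fun i _ => ?_) ⟨i₀, Finset.mem_univ _, hsq i₀ ?_⟩
    · rcases eq_or_ne (p i) 0 with hi | hi
      · simp [hi]
      · exact (hsq i hi).le
    · rintro h
      simp [h] at hi₀
  simp_rw [mul_pow, ← Finset.mul_sum] at hsum
  nlinarith [sq_nonneg δ]

variable [NormedSpace ℝ E] {x p : E}

theorem norm_normalize_sub_normalize_le (hx : x ≠ 0) (hp : p ≠ 0) (hxp : ‖x - p‖ ≤ δ * ‖p‖) :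
    ‖NormedSpace.normalize x - NormedSpace.normalize p‖ ≤ 2 * δ := by
  have hx₀ := norm_pos_iff.2 hx
  have hp₀ := norm_pos_iff.2 hp
  have hrescale : ‖(‖x‖⁻¹ - ‖p‖⁻¹) • x‖ ≤ δ := by
    rw [norm_smul, Real.norm_eq_abs, inv_sub_inv hx₀.ne' hp₀.ne', abs_div,
      abs_of_pos (mul_pos hx₀ hp₀), abs_sub_comm, div_mul_eq_mul_div, mul_comm (‖x‖) (‖p‖),
      mul_div_mul_right _ _ hx₀.ne', div_le_iff₀ hp₀]
    exact (abs_norm_sub_norm_le x p).trans hxp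
  have hdiff : ‖‖p‖⁻¹ • (x - p)‖ ≤ δ := by
    rwa [norm_smul, norm_inv, norm_norm, inv_mul_eq_div, div_le_iff₀ hp₀]
  calc ‖NormedSpace.normalize x - NormedSpace.normalize p‖
      = ‖(‖x‖⁻¹ - ‖p‖⁻¹) • x + ‖p‖⁻¹ • (x - p)‖ := by
        rw [NormedSpace.normalize, NormedSpace.normalize, sub_smul, smul_sub, sub_add_sub_cancel]
    _ ≤ 2 * δ := (norm_add_le_of_le hrescale hdiff).trans_eq (two_mul δ).symm

end Normalization

theorem ApproxByPEPS.smul {V : Type*} [Fintype V] [DecidableEq V] [Nonempty V]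
    {G : SimpleGraph V} [DecidableRel G.Adj] {d D : ℕ} {ε : ℝ} {ψ : SpinVec V d}
    (hψ : ApproxByPEPS G D ε ψ) {c : ℂ} (hc : ‖c‖ = 1) : ApproxByPEPS G D ε (c • ψ) := by
  obtain ⟨φ, hφ, hφ_norm, hφψ⟩ := hψ
  refine ⟨c • φ, hφ.smul c, by rw [norm_smul, hc, hφ_norm, one_mul], ?_⟩
  rwa [← smul_sub, norm_smul, hc, one_mul]

namespace EdgeInteraction

variable {V : Type*} [Fintype V] [DecidableEq V] {G : SimpleGraph V} {d : ℕ}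
  (h : EdgeInteraction G d)

section Projector

variable [DecidableRel G.Adj]

theorem groundProjector_col_mem (τ : V → Fin d) :
    (WithLp.toLp 2 fun σ => h.groundProjector σ τ : SpinVec V d) ∈ h.groundSpace := by
  have hcol : (WithLp.toLp 2 fun σ => h.groundProjector σ τ : SpinVec V d) =
      Matrix.toEuclideanCLM (𝕜 := ℂ) h.groundProjector (WithLp.toLp 2 (Pi.single τ 1)) := by
    rw [Matrix.toEuclideanCLM_toLp, Matrix.mulVec_single_one]
    rfl
  rw [hcol, groundProjector, StarAlgEquiv.apply_symm_apply]
  exact Submodule.starProjection_apply_mem _ _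

theorem isStarProjection_groundProjector : IsStarProjection h.groundProjector :=
  have hproj := isStarProjection_starProjection (U := h.groundSpace)
  ⟨hproj.isIdempotentElem.map (Matrix.toEuclideanCLM (𝕜 := ℂ)).symm.toMulEquiv,
    ((Matrix.toEuclideanCLM (𝕜 := ℂ)).symm.map_star' _).symm.trans
      (congrArg _ hproj.isSelfAdjoint.star_eq)⟩

theorem sum_norm_sq_groundProjector_col :
    ∑ τ, ‖(WithLp.toLp 2 fun σ => h.groundProjector σ τ : SpinVec V d)‖ ^ 2 = h.degeneracy := by
  have hproj : h.groundProjector.conjTranspose * h.groundProjector = h.groundProjector :=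
    (congrArg (· * h.groundProjector) h.isStarProjection_groundProjector.isSelfAdjoint).trans
      h.isStarProjection_groundProjector.isIdempotentElem
  have htrace :
      ((∑ τ, ‖(WithLp.toLp 2 fun σ => h.groundProjector σ τ : SpinVec V d)‖ ^ 2 : ℝ) : ℂ) =
        (h.groundProjector.conjTranspose * h.groundProjector).trace := by
    simp [EuclideanSpace.norm_sq_eq, Matrix.trace, Matrix.mul_apply, Complex.conj_mul']
  rw [hproj, trace_groundProjector] at htrace
  exact_mod_cast htrace

end Projector

/-- The squared column norms of `A - P` add up to at most `δ ^ 2` and those of `P` to at least `1`,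
so some column of `A` is relatively close to that of `P`, which is a ground state. -/
theorem exists_approxByPEPS [DecidableRel G.Adj] [Nonempty V] (hd : 0 < d) {A : SpinOp V d} {D : ℕ}
    {δ : ℝ} (hA : IsPEPO G D A) (hδ : δ < 1) (hAP : traceNorm (A - h.groundProjector) ≤ δ) :
    ∃ ψ ∈ h.groundSpace, ‖ψ‖ = 1 ∧ ApproxByPEPS G D (2 * δ) ψ := by
  let col (B : SpinOp V d) (τ : V → Fin d) : SpinVec V d := WithLp.toLp 2 fun σ => B σ τ
  have hsum : ∑ τ, ‖col A τ - col h.groundProjector τ‖ ^ 2 ≤ δ ^ 2 := by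
    have hentries : ∑ τ, ‖col A τ - col h.groundProjector τ‖ ^ 2 =
        ∑ σ, ∑ τ, ‖(A - h.groundProjector) σ τ‖ ^ 2 := by
      rw [Finset.sum_comm]
      exact Finset.sum_congr rfl fun τ _ => EuclideanSpace.norm_sq_eq _
    rw [hentries]
    exact (sum_norm_sq_le_traceNorm_sq _).trans (pow_le_pow_left₀ (traceNorm_nonneg _) hAP 2)
  obtain ⟨τ, hP, hle⟩ := exists_norm_sub_le_mul_norm ((traceNorm_nonneg _).trans hAP) hsum
    ((Nat.one_le_cast.2 (h.one_le_degeneracy hd)).trans_eq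
      h.sum_norm_sq_groundProjector_col.symm)
  have hA₀ : col A τ ≠ 0 := fun hzero => by
    rw [hzero, zero_sub, norm_neg] at hle
    nlinarith [norm_pos_iff.2 hP]
  refine ⟨NormedSpace.normalize (col h.groundProjector τ), ?_,
    NormedSpace.norm_normalize_eq_one_iff.2 hP, NormedSpace.normalize (col A τ), ?_,
    NormedSpace.norm_normalize_eq_one_iff.2 hA₀, norm_normalize_sub_normalize_le hA₀ hP hle⟩
  · exact h.groundSpace.smul_of_tower_mem _ (h.groundProjector_col_mem τ)
  · rw [NormedSpace.normalize, ← Complex.coe_smul]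
    exact (hA.isPEPS_col τ).smul _

theorem approxByPEPS_of_finrank_eq_one [DecidableRel G.Adj] [Nonempty V] {D : ℕ} {ε : ℝ}
    (hex : ∃ ψ ∈ h.groundSpace, ‖ψ‖ = 1 ∧ ApproxByPEPS G D ε ψ)
    (hrank : Module.finrank ℂ h.groundSpace = 1) {ψ : SpinVec V d} (hψ : ψ ∈ h.groundSpace)
    (hψ_norm : ‖ψ‖ = 1) : ApproxByPEPS G D ε ψ := by
  obtain ⟨ψ₀, hψ₀, hψ₀_norm, happrox⟩ := hex
  have hne : (⟨ψ₀, hψ₀⟩ : h.groundSpace) ≠ 0 :=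
    fun hzero => norm_ne_zero_iff.1 (hψ₀_norm ▸ one_ne_zero) (congrArg Subtype.val hzero)
  obtain ⟨c, hc⟩ := (finrank_eq_one_iff_of_nonzero' _ hne).1 hrank ⟨ψ, hψ⟩
  obtain rfl : c • ψ₀ = ψ := congrArg Subtype.val hc
  rw [norm_smul, hψ₀_norm, mul_one] at hψ_norm
  exact happrox.smul hψ_norm

end EdgeInteraction

theorem ApproxByPEPS.mono {V : Type*} [Fintype V] [DecidableEq V] {G : SimpleGraph V}
    [DecidableRel G.Adj] {d D : ℕ} {ε ε' : ℝ} {ψ : SpinVec V d} (hψ : ApproxByPEPS G D ε ψ)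
    (hε : ε ≤ ε') : ApproxByPEPS G D ε' ψ :=
  let ⟨φ, hφ, hφ_norm, hφψ⟩ := hψ
  ⟨φ, hφ, hφ_norm, hφψ.trans hε⟩

namespace EdgeInteraction

variable {V : Type*} [Fintype V] [DecidableEq V] {G : SimpleGraph V} [DecidableRel G.Adj] {d : ℕ}

theorem GroundStateApproximation.mono {h : EdgeInteraction G d} {K : ℕ} {ord : Fin K ≃ G.edgeSet}
    {ε ε' β : ℝ} {M L D : ℕ} (happrox : h.GroundStateApproximation ord ε β M L D) (hε : ε ≤ ε') :
    h.GroundStateApproximation ord ε' β M L D :=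
  let ⟨hgibbs, hpepo, htrotter, ⟨ψ, hψ, hψ_norm, hpeps⟩, hunique⟩ := happrox
  ⟨hgibbs.trans hε, hpepo, htrotter.trans hε, ⟨ψ, hψ, hψ_norm, hpeps.mono hε⟩,
    fun hrank φ hφ hφ_norm => (hunique hrank φ hφ hφ_norm).mono hε⟩

variable (h : EdgeInteraction G d)

theorem traceNorm_rescaled_compressedTrotter_sub_le_of_le (hd : 0 < d) {K : ℕ}
    (ord : Fin K ≃ G.edgeSet) {β δ W : ℝ} {M L : ℕ} (hβ : 0 ≤ β) (hM : 0 < M) (hδ : δ < 1)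
    (hexcited : h.excitedWeight β ≤ δ / 2) (hW : h.degeneracy + h.excitedWeight β ≤ W)
    (hMβ : 2 * β * K ≤ M) (hMW : 32 * (β ^ 2 * K ^ 2 * W) ≤ δ * M)
    (hLW : 32 * (K * W * Real.exp (7 * β)) ≤ δ * 2 ^ L) :
    traceNorm ((Real.exp (β * h.groundEnergy) : ℂ) • h.compressedTrotter ord β M L -
      h.groundProjector) ≤ δ := by
  set y : ℝ := 4 * β ^ 2 * K ^ 2 / M + 2 * K * ((1 / 2) ^ L * Real.exp (7 * β)) with hy_def
  have hW_one : 1 ≤ W := by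
    linarith [h.excitedWeight_nonneg β, (Nat.one_le_cast (α := ℝ)).2 (h.one_le_degeneracy hd)]
  have htrotter : W * (4 * β ^ 2 * K ^ 2 / M) ≤ δ / 8 := by
    rw [mul_div_assoc', div_le_iff₀ (Nat.cast_pos.2 hM)]
    linarith
  have hcompress : W * (2 * K * ((1 / 2) ^ L * Real.exp (7 * β))) ≤ δ / 8 := by
    rw [one_div, inv_pow, inv_mul_eq_div, mul_div_assoc', mul_div_assoc',
      div_le_iff₀ (by positivity)]
    linarith [mul_nonneg (mul_nonneg K.cast_nonneg (zero_le_one.trans hW_one))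
      (Real.exp_pos (7 * β)).le]
  have hy : 0 ≤ y := by positivity
  have : W * y ≤ δ / 4 := by
    rw [hy_def, mul_add]
    linarith
  have hy_one : y ≤ 1 := by nlinarith
  have hexp : Real.exp y - 1 ≤ 2 * y := by
    simpa only [abs_of_nonneg hy] using
      (le_abs_self _).trans (Real.abs_exp_sub_one_le (x := y) (by rwa [abs_of_nonneg hy]))
  calc _ ≤ _ := h.traceNorm_rescaled_compressedTrotter_sub_le ord hd hβ hM hMβ L
    _ ≤ W * (2 * y) + δ / 2 := by
      gcongr
      exact sub_nonneg.2 (Real.one_le_exp hy)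
    _ ≤ δ := by linarith

theorem groundStateApproximation_of_le (hd : 0 < d) [Nonempty V] {K : ℕ}
    (ord : Fin K ≃ G.edgeSet) {β δ W : ℝ} {M L : ℕ} (hβ : 0 ≤ β) (hM : 0 < M) (hδ : δ < 1)
    (hexcited : h.excitedWeight β ≤ δ / 2) (hW : h.degeneracy + h.excitedWeight β ≤ W)
    (hMβ : 2 * β * K ≤ M) (hMW : 32 * (β ^ 2 * K ^ 2 * W) ≤ δ * M)
    (hLW : 32 * (K * W * Real.exp (7 * β)) ≤ δ * 2 ^ L) :
    h.GroundStateApproximation ord (2 * δ) β M L (bondDim d M L) := by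
  have hδ₀ : 0 ≤ δ := by linarith [h.excitedWeight_nonneg β]
  have hpepo := (h.isPEPO_compressedTrotter ord β M L).smul (Real.exp (β * h.groundEnergy) : ℂ)
  have htrotter := h.traceNorm_rescaled_compressedTrotter_sub_le_of_le hd ord hβ hM hδ hexcited
    hW hMβ hMW hLW
  have hpeps := h.exists_approxByPEPS hd hpepo hδ htrotter
  exact ⟨(h.traceNorm_gibbs_sub_le hd β).trans (by linarith), hpepo, htrotter.trans (by linarith),
    hpeps, fun hrank _ hψ hψ_norm => h.approxByPEPS_of_finrank_eq_one hpeps hrank hψ hψ_norm⟩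

theorem excitedWeight_eq_zero [IsEmpty G.edgeSet] (hd : 0 < d) (β : ℝ) :
    h.excitedWeight β = 0 := by
  have hH : h.hamiltonian = 0 := by rw [hamiltonian, Finset.univ_eq_empty, Finset.sum_empty]
  have henergy (i : V → Fin d) : h.energy i = 0 :=
    congrFun (h.isHermitian_hamiltonian.eigenvalues_eq_zero_iff.2 hH) i
  obtain ⟨i₀, hi₀⟩ := h.exists_energy_eq_groundEnergy hd
  rw [excitedWeight, Finset.filter_false_of_mem, Finset.sum_empty]
  intro i _
  rw [← hi₀, henergy, henergy]
  exact not_ne_iff.2 rfl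

theorem groundStateApproximation_of_isEmpty_edgeSet (hd : 0 < d) [Nonempty V]
    [IsEmpty G.edgeSet] {K : ℕ} (ord : Fin K ≃ G.edgeSet) {ε : ℝ} (hε : 0 < ε) :
    h.GroundStateApproximation ord ε 0 1 0 (bondDim d 1 0) := by
  have := ord.isEmpty
  obtain rfl : K = 0 := (Fintype.card_fin K).symm.trans Fintype.card_eq_zero
  have hδ : (0 : ℝ) < min ε 1 / 2 := by positivity
  refine (h.groundStateApproximation_of_le hd ord (δ := min ε 1 / 2) (W := h.degeneracy) le_rfl
    one_pos (by linarith [min_le_right ε 1]) ?_ ?_ ?_ ?_ ?_).mono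
    ((mul_div_cancel₀ _ two_ne_zero).trans_le (min_le_left ε 1))
  · simpa only [h.excitedWeight_eq_zero hd] using half_pos hδ |>.le
  · rw [h.excitedWeight_eq_zero hd, add_zero]
  · simp
  · simpa using hδ.le
  · simpa using hδ.le

end EdgeInteraction

section Parameters

variable {Λ ε : ℝ}

theorem half_le_log_two : 1 / 2 ≤ Real.log 2 := by linarith [Real.log_two_gt_d9]

theorem exists_le_exp_mul (x : ℝ) : ∃ s, 0 ≤ s ∧ ∀ Λ, Real.log 2 ≤ Λ → x ≤ Real.exp (s * Λ) := by
  refine ⟨2 * |x|, by positivity, fun Λ hΛ => ?_⟩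
  calc x ≤ 2 * |x| * Λ := by nlinarith [le_abs_self x, abs_nonneg x, half_le_log_two]
    _ ≤ Real.exp (2 * |x| * Λ) := by linarith [Real.add_one_le_exp (2 * |x| * Λ)]

theorem two_pow_le_exp_mul (hΛ : Real.log 2 ≤ Λ) (n : ℕ) : (2 : ℝ) ^ n ≤ Real.exp (n * Λ) := by
  rw [Real.exp_nat_mul]
  gcongr
  exact (Real.log_le_iff_le_exp two_pos).1 hΛ

theorem two_mul_exp_mul_le (hΛ : Real.log 2 ≤ Λ) (s : ℝ) :
    2 * Real.exp (s * Λ) ≤ Real.exp ((s + 1) * Λ) := by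
  rw [add_one_mul, Real.exp_add, mul_comm]
  gcongr
  exact (Real.log_le_iff_le_exp two_pos).1 hΛ

theorem mul_exp_mul_le (hΛ : Real.log 2 ≤ Λ) (hε : Real.exp (-Λ) ≤ ε) (s : ℝ) :
    32 * Real.exp (s * Λ) ≤ ε / 2 * Real.exp ((s + 7) * Λ) := by
  have h64 := two_pow_le_exp_mul hΛ 6
  calc 32 * Real.exp (s * Λ) = 2 ^ 6 / 2 * Real.exp (s * Λ) := by norm_num
    _ ≤ Real.exp ((6 : ℕ) * Λ) / 2 * Real.exp (s * Λ) := by gcongr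
    _ = Real.exp (-Λ) / 2 * Real.exp ((s + 7) * Λ) := by
      rw [div_mul_eq_mul_div, div_mul_eq_mul_div, ← Real.exp_add, ← Real.exp_add]
      push_cast
      ring_nf
    _ ≤ ε / 2 * Real.exp ((s + 7) * Λ) := by gcongr

theorem natCeil_exp_mul_le (hΛ : Real.log 2 ≤ Λ) {m : ℝ} (hm : 0 ≤ m) :
    (⌈Real.exp (m * Λ)⌉₊ : ℝ) ≤ Real.exp ((m + 1) * Λ) := by
  have hΛ₀ : 0 ≤ Λ := (Real.log_nonneg one_le_two).trans hΛ
  refine (Nat.ceil_le_two_mul ?_).trans (two_mul_exp_mul_le hΛ m)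
  linarith [Real.one_le_exp (mul_nonneg hm hΛ₀)]

theorem exp_mul_le_two_pow_natCeil (l Λ : ℝ) :
    Real.exp (l * Λ) ≤ 2 ^ ⌈2 * l * Λ⌉₊ := by
  rw [← Real.le_log_iff_exp_le (by positivity), Real.log_pow]
  calc l * Λ = 2 * l * Λ * (1 / 2) := by ring
    _ ≤ ⌈2 * l * Λ⌉₊ * Real.log 2 := by
      gcongr
      · exact Nat.le_ceil _
      · exact half_le_log_two

theorem natCeil_two_mul_mul_le (hΛ : Real.log 2 ≤ Λ) {l : ℝ} (hl : 0 ≤ l) :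
    (⌈2 * l * Λ⌉₊ : ℝ) ≤ (2 * l + 2) * Λ := by
  have hΛ₀ : 0 ≤ Λ := (Real.log_nonneg one_le_two).trans hΛ
  linarith [Nat.ceil_lt_add_one (mul_nonneg (mul_nonneg zero_le_two hl) hΛ₀), half_le_log_two]

theorem rpow_mul_exp_neg_le {X s r : ℝ} (hΛ : Real.log 2 ≤ Λ) (hε : Real.exp (-Λ) ≤ ε)
    (hX₀ : 0 ≤ X) (hX : X ≤ Real.exp (s * Λ)) (hr : 0 ≤ r) :
    X ^ r * Real.exp (-((s * r + 4) * Λ)) ≤ ε / 8 := by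
  have hε₀ : 0 ≤ ε := (Real.exp_pos _).le.trans hε
  have h8 := two_pow_le_exp_mul hΛ 3
  calc X ^ r * Real.exp (-((s * r + 4) * Λ))
      ≤ Real.exp (s * Λ) ^ r * Real.exp (-((s * r + 4) * Λ)) := by gcongr
    _ = Real.exp (-Λ) / Real.exp ((3 : ℕ) * Λ) := by
      rw [← Real.exp_mul, ← Real.exp_add, ← Real.exp_sub]
      push_cast
      ring_nf
    _ ≤ ε / 2 ^ 3 := by gcongr
    _ = ε / 8 := by norm_num

theorem rpow_add_one_le {X s q : ℝ} (hΛ : Real.log 2 ≤ Λ) (hX₁ : 1 ≤ X)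
    (hX : X ≤ Real.exp (s * Λ)) (hq : 0 ≤ q) : X ^ q + 1 ≤ Real.exp ((s * q + 1) * Λ) := by
  have hXq : X ^ q ≤ Real.exp (s * q * Λ) := by
    rw [mul_right_comm, Real.exp_mul]
    exact Real.rpow_le_rpow (zero_le_one.trans hX₁) hX hq
  linarith [two_mul_exp_mul_le hΛ (s * q), Real.one_le_rpow hX₁ hq]

theorem one_add_mul_sq_pow_le {m l η : ℝ} {M L d : ℕ} (hΛ : Real.log 2 ≤ Λ) (hM : 0 < M)
    (hd : 0 < d) (hMm : M ≤ Real.exp (m * Λ)) (hdη : d ≤ Real.exp (η * Λ)) (hL : L ≤ l * Λ)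
    (hg : 0 ≤ m + 2 * η + 1) :
    (1 + (M : ℝ) * d ^ 2) ^ (2 * L) ≤ Real.exp (2 * l * (m + 2 * η + 1) * Λ ^ 2) := by
  have hΛ₀ : 0 ≤ Λ := (Real.log_nonneg one_le_two).trans hΛ
  have hbase : 1 + (M : ℝ) * d ^ 2 ≤ Real.exp ((m + 2 * η + 1) * Λ) :=
    calc 1 + (M : ℝ) * d ^ 2 ≤ 2 * (M * d ^ 2) := by
          have : (1 : ℝ) ≤ M * d ^ 2 := by exact_mod_cast Nat.mul_pos hM (pow_pos hd 2)
          linarith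
      _ ≤ 2 * (Real.exp (m * Λ) * Real.exp (η * Λ) ^ 2) := by gcongr
      _ = 2 * Real.exp ((m + 2 * η) * Λ) := by
        rw [← Real.exp_nat_mul, ← Real.exp_add]
        push_cast
        ring_nf
      _ ≤ _ := two_mul_exp_mul_le hΛ _
  calc (1 + (M : ℝ) * d ^ 2) ^ (2 * L) ≤ Real.exp ((m + 2 * η + 1) * Λ) ^ (2 * L) := by gcongr
    _ = Real.exp (2 * L * ((m + 2 * η + 1) * Λ)) := by rw [← Real.exp_nat_mul]; push_cast; rfl
    _ ≤ Real.exp (2 * (l * Λ) * ((m + 2 * η + 1) * Λ)) := by gcongr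
    _ = Real.exp (2 * l * (m + 2 * η + 1) * Λ ^ 2) := by ring_nf

theorem two_mul_mul_mul_le_exp {b κ K : ℝ} (hΛ : Real.log 2 ≤ Λ) (hK₀ : 0 ≤ K)
    (hK : K ≤ Real.exp (κ * Λ)) : 2 * (b * Λ) * K ≤ Real.exp ((b + κ + 1) * Λ) := by
  have hβ : b * Λ ≤ Real.exp (b * Λ) := by linarith [Real.add_one_le_exp (b * Λ)]
  calc 2 * (b * Λ) * K ≤ 2 * (Real.exp (b * Λ) * Real.exp (κ * Λ)) := by
        rw [mul_assoc]
        gcongr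
    _ = 2 * Real.exp ((b + κ) * Λ) := by rw [← Real.exp_add, add_mul]
    _ ≤ Real.exp ((b + κ + 1) * Λ) := two_mul_exp_mul_le hΛ _

theorem mul_sq_mul_sq_mul_exp_le {b κ K : ℝ} (hΛ : Real.log 2 ≤ Λ) (hε : Real.exp (-Λ) ≤ ε)
    (hb : 0 ≤ b) (hK₀ : 0 ≤ K) (hK : K ≤ Real.exp (κ * Λ)) (w : ℝ) :
    32 * ((b * Λ) ^ 2 * K ^ 2 * Real.exp (w * Λ)) ≤
      ε / 2 * Real.exp ((2 * b + 2 * κ + w + 7) * Λ) := by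
  have hΛ₀ : 0 ≤ Λ := (Real.log_nonneg one_le_two).trans hΛ
  have : 0 ≤ b * Λ := mul_nonneg hb hΛ₀
  have hβ : b * Λ ≤ Real.exp (b * Λ) := by linarith [Real.add_one_le_exp (b * Λ)]
  calc 32 * ((b * Λ) ^ 2 * K ^ 2 * Real.exp (w * Λ))
      ≤ 32 * (Real.exp (b * Λ) ^ 2 * Real.exp (κ * Λ) ^ 2 * Real.exp (w * Λ)) := by gcongr
    _ = 32 * Real.exp ((2 * b + 2 * κ + w) * Λ) := by
      rw [← Real.exp_nat_mul, ← Real.exp_nat_mul, ← Real.exp_add, ← Real.exp_add]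
      push_cast
      ring_nf
    _ ≤ ε / 2 * Real.exp ((2 * b + 2 * κ + w + 7) * Λ) := mul_exp_mul_le hΛ hε _

theorem mul_exp_mul_exp_le {κ K : ℝ} (hΛ : Real.log 2 ≤ Λ) (hε : Real.exp (-Λ) ≤ ε)
    (hK : K ≤ Real.exp (κ * Λ)) (b w : ℝ) :
    32 * (K * Real.exp (w * Λ) * Real.exp (7 * (b * Λ))) ≤
      ε / 2 * Real.exp ((κ + w + 7 * b + 7) * Λ) :=
  calc 32 * (K * Real.exp (w * Λ) * Real.exp (7 * (b * Λ)))
      ≤ 32 * (Real.exp (κ * Λ) * Real.exp (w * Λ) * Real.exp (7 * (b * Λ))) := by gcongr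
    _ = 32 * Real.exp ((κ + w + 7 * b) * Λ) := by
      rw [← Real.exp_add, ← Real.exp_add]
      ring_nf
    _ ≤ ε / 2 * Real.exp ((κ + w + 7 * b + 7) * Λ) := mul_exp_mul_le hΛ hε _

/-- With every quantity bounded by an exponential in `Λ` and `β = b * Λ`, it suffices to take `M`
exponential and `L` linear in `Λ`. -/
theorem exists_trotterNumber_cutoff {b w κ η : ℝ} (hb : 0 ≤ b) (hw : 0 ≤ w) (hκ : 0 ≤ κ)
    (hη : 0 ≤ η) :
    ∃ C : ℝ, 0 < C ∧ ∀ {Λ ε : ℝ} {K d : ℕ}, Real.log 2 ≤ Λ → Real.exp (-Λ) ≤ ε →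
      K ≤ Real.exp (κ * Λ) → 0 < d → d ≤ Real.exp (η * Λ) →
      ∃ M L : ℕ, 0 < M ∧ (1 + (M : ℝ) * d ^ 2) ^ (2 * L) ≤ Real.exp (C * Λ ^ 2) ∧
        2 * (b * Λ) * K ≤ M ∧
        32 * ((b * Λ) ^ 2 * K ^ 2 * Real.exp (w * Λ)) ≤ ε / 2 * M ∧
        32 * (K * Real.exp (w * Λ) * Real.exp (7 * (b * Λ))) ≤ ε / 2 * 2 ^ L := by
  set m := 2 * b + 2 * κ + w + 7
  set l := κ + w + 7 * b + 7
  have hm : b + κ + 1 ≤ m := by linarith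
  refine ⟨2 * (2 * l + 2) * ((m + 1) + 2 * η + 1), by positivity, ?_⟩
  intro Λ ε K d hΛ hε hK hd hdη
  have hΛ₀ : 0 ≤ Λ := (Real.log_nonneg one_le_two).trans hΛ
  have hε₀ : 0 ≤ ε := (Real.exp_pos _).le.trans hε
  have hceil : Real.exp (m * Λ) ≤ ⌈Real.exp (m * Λ)⌉₊ := Nat.le_ceil _
  have hM := Nat.ceil_pos.2 (Real.exp_pos (m * Λ))
  refine ⟨⌈Real.exp (m * Λ)⌉₊, ⌈2 * l * Λ⌉₊, hM, one_add_mul_sq_pow_le hΛ hM hd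
    (natCeil_exp_mul_le hΛ (by positivity)) hdη (natCeil_two_mul_mul_le hΛ (by positivity))
    (by positivity), ?_, ?_, ?_⟩
  · calc 2 * (b * Λ) * K ≤ Real.exp ((b + κ + 1) * Λ) :=
          two_mul_mul_mul_le_exp hΛ K.cast_nonneg hK
      _ ≤ Real.exp (m * Λ) := by gcongr
      _ ≤ ⌈Real.exp (m * Λ)⌉₊ := hceil
  · exact (mul_sq_mul_sq_mul_exp_le hΛ hε hb K.cast_nonneg hK w).trans (by gcongr)
  · refine (mul_exp_mul_exp_le hΛ hε hK b w).trans ?_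
    gcongr
    exact exp_mul_le_two_pow_natCeil l Λ

end Parameters

theorem log_two_le_log_div {N ε : ℝ} (hN : 2 ≤ N) (hε : 0 < ε) (hε_one : ε ≤ 1) :
    Real.log 2 ≤ Real.log (N / ε) :=
  Real.log_le_log two_pos ((le_div_iff₀ hε).2 (by nlinarith))

theorem le_exp_log_div {N ε : ℝ} (hN : 0 < N) (hε : 0 < ε) (hε_one : ε ≤ 1) :
    N ≤ Real.exp (Real.log (N / ε)) := by
  rw [Real.exp_log (div_pos hN hε)]
  exact le_div_self hN.le hε hε_one

theorem exp_neg_log_div_le {N ε : ℝ} (hN : 1 ≤ N) (hε : 0 < ε) :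
    Real.exp (-Real.log (N / ε)) ≤ ε := by
  rw [← Real.log_inv, inv_div, Real.exp_log (by positivity)]
  exact div_le_self hε.le hN

theorem card_edgeSet_le {V : Type*} [Fintype V] (G : SimpleGraph V) [DecidableRel G.Adj]
    [Fintype G.edgeSet] {z : ℕ} (hz : ∀ v, G.degree v ≤ z) :
    Fintype.card G.edgeSet ≤ z * Fintype.card V := by
  classical
  have hsum : ∑ v, G.degree v ≤ Fintype.card V * z := by
    simpa only [smul_eq_mul, Finset.card_univ] using
      Finset.sum_le_card_nsmul Finset.univ _ z fun v _ => hz v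
  have htwice : ∑ v, G.degree v = 2 * G.edgeFinset.card := by
    convert G.sum_degrees_eq_twice_card_edges
  rw [← SimpleGraph.edgeFinset_card]
  linarith

theorem EdgeInteraction.groundStateApproximation_of_le_exp {V : Type*} [Fintype V] [DecidableEq V]
    [Nonempty V] {G : SimpleGraph V} [DecidableRel G.Adj] {d K M L : ℕ} {Δ c p q s b Λ ε : ℝ}
    {h : EdgeInteraction G d} (hd : 0 < d) (hΔ : 0 < Δ) (hp : 0 ≤ p) (hq : 0 ≤ q)
    (hgap : h.HasGap Δ) (hD : h.PolynomialDensityOfStates c p q) (ord : Fin K ≃ G.edgeSet)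
    (hΛ : Real.log 2 ≤ Λ) (hε : Real.exp (-Λ) ≤ ε) (hε_one : ε < 1)
    (hX_one : 1 ≤ c * Fintype.card V) (hX : c * Fintype.card V ≤ Real.exp (s * Λ))
    (hb : 0 ≤ b) (hbΔ : b * Δ = s * (2 * p * Δ + q) + 4) (hM : 0 < M)
    (hMβ : 2 * (b * Λ) * K ≤ M)
    (hMW : 32 * ((b * Λ) ^ 2 * K ^ 2 * Real.exp ((s * q + 1) * Λ)) ≤ ε / 2 * M)
    (hLW : 32 * (K * Real.exp ((s * q + 1) * Λ) * Real.exp (7 * (b * Λ))) ≤ ε / 2 * 2 ^ L) :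
    h.GroundStateApproximation ord ε (b * Λ) M L (bondDim d M L) := by
  have hβ : 0 ≤ b * Λ := mul_nonneg hb ((Real.log_nonneg one_le_two).trans hΛ)
  have hgibbs : (c * Fintype.card V) ^ (2 * p * Δ + q) * Real.exp (-(b * Λ * Δ)) ≤ ε / 8 := by
    rw [mul_right_comm b, hbΔ]
    exact rpow_mul_exp_neg_le hΛ hε (zero_le_one.trans hX_one) hX (by positivity)
  have hexcited : h.excitedWeight (b * Λ) ≤ 2 * (ε / 8) :=
    hD.excitedWeight_le hgap hX_one hΔ hp hq hβ hgibbs (by linarith)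
  have hW := rpow_add_one_le hΛ hX_one hX hq
  rw [← mul_div_cancel₀ ε two_ne_zero]
  exact h.groundStateApproximation_of_le hd ord hβ hM (by linarith) (by linarith)
    (by linarith [hD.degeneracy_le]) hMβ hMW hLW

universe u

theorem exists_groundStateApproximation_of_two_le_card {d z : ℕ} (hd : 0 < d) {Δ c p q : ℝ}
    (hΔ : 0 < Δ) (hc : 1 ≤ c) (hp : 0 ≤ p) (hq : 0 ≤ q) :
    ∃ C : ℝ, 0 < C ∧ ∀ {V : Type u} [Fintype V] [DecidableEq V] {G : SimpleGraph V}
      [DecidableRel G.Adj], 2 ≤ Fintype.card V → (∀ v, G.degree v ≤ z) →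
      ∀ {h : EdgeInteraction G d}, h.HasGap Δ → h.PolynomialDensityOfStates c p q →
      ∀ (ord : Fin (Fintype.card G.edgeSet) ≃ G.edgeSet) {ε : ℝ}, 0 < ε → ε < 1 →
        ∃ (β : ℝ) (M L D : ℕ), 0 ≤ β ∧ 0 < M ∧
          β ≤ C * Real.log (Fintype.card V / ε) ∧
          (D : ℝ) ≤ Real.exp (C * Real.log (Fintype.card V / ε) ^ 2) ∧
          h.GroundStateApproximation ord ε β M L D := by
  obtain ⟨c', hc', hc_le⟩ := exists_le_exp_mul c
  obtain ⟨z', hz', hz_le⟩ := exists_le_exp_mul z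
  obtain ⟨η, hη, hη_le⟩ := exists_le_exp_mul d
  set b := ((c' + 1) * (2 * p * Δ + q) + 4) / Δ
  have hb : 0 ≤ b := by positivity
  obtain ⟨C, hC, hparams⟩ := exists_trotterNumber_cutoff hb
    (show 0 ≤ (c' + 1) * q + 1 by positivity) (show 0 ≤ z' + 1 by positivity) hη
  refine ⟨b + C, by positivity, fun {V} _ _ G _ hV hdeg h hgap hD ord ε hε hε_one => ?_⟩
  have : Nonempty V := Fintype.card_pos_iff.1 (by omega)
  have hN : (2 : ℝ) ≤ Fintype.card V := Nat.ofNat_le_cast.2 hV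
  have hΛ := log_two_le_log_div hN hε hε_one.le
  have hΛN := le_exp_log_div (two_pos.trans_le hN) hε hε_one.le
  have hΛε := exp_neg_log_div_le (one_le_two.trans hN) hε
  set Λ := Real.log (Fintype.card V / ε)
  have hΛ₀ : 0 ≤ Λ := (Real.log_nonneg one_le_two).trans hΛ
  have hmul {x x' : ℝ} (hx : x ≤ Real.exp (x' * Λ)) :
      x * Fintype.card V ≤ Real.exp ((x' + 1) * Λ) := by
    rw [add_one_mul, Real.exp_add]
    gcongr
  obtain ⟨M, L, hM, hbond, hMβ, hMW, hLW⟩ := hparams hΛ hΛε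
    (le_trans (mod_cast card_edgeSet_le G hdeg) (hmul (hz_le Λ hΛ))) hd (hη_le Λ hΛ)
  refine ⟨b * Λ, M, L, EdgeInteraction.bondDim d M L, by positivity, hM, ?_, ?_,
    EdgeInteraction.groundStateApproximation_of_le_exp hd hΔ hp hq hgap hD ord hΛ hΛε hε_one
      (by nlinarith) (hmul (hc_le Λ hΛ)) hb (div_mul_cancel₀ _ hΔ.ne') hM hMβ hMW hLW⟩
  · gcongr
    linarith
  · refine (Nat.cast_le.2 (EdgeInteraction.bondDim_le d M L)).trans ?_
    push_cast
    exact hbond.trans (by gcongr; linarith)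

theorem EdgeInteraction.exists_groundStateApproximation_of_card_eq_one {V : Type*} [Fintype V]
    [DecidableEq V] {G : SimpleGraph V} [DecidableRel G.Adj] {d K : ℕ} (h : EdgeInteraction G d)
    (hd : 0 < d) (hV : Fintype.card V = 1) (ord : Fin K ≃ G.edgeSet) {ε b D₀ : ℝ} (hε : 0 < ε)
    (hb : 0 ≤ b) (hD₀ : 1 ≤ D₀) :
    ∃ (β : ℝ) (M L D : ℕ), 0 ≤ β ∧ 0 < M ∧ β ≤ b ∧ D ≤ D₀ ∧
      h.GroundStateApproximation ord ε β M L D := by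
  have : Subsingleton V := Fintype.card_le_one_iff_subsingleton.1 hV.le
  have : Nonempty V := Fintype.card_pos_iff.1 (by omega)
  obtain rfl : G = ⊥ := Subsingleton.elim _ _
  have : IsEmpty (⊥ : SimpleGraph V).edgeSet := by
    rw [SimpleGraph.edgeSet_bot]
    infer_instance
  have hbond : bondDim d 1 0 ≤ 1 := bondDim_le d 1 0
  exact ⟨0, 1, 0, _, le_rfl, one_pos, hb, (Nat.cast_le_one.2 hbond).trans hD₀,
    h.groundStateApproximation_of_isEmpty_edgeSet hd ord hε⟩

theorem exists_log_div_min_rpow_le {a k : ℝ} (ha : 0 < a) (hk : 0 ≤ k) :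
    ∃ C : ℝ, 1 ≤ C ∧ ∀ {N : ℝ}, 2 ≤ N →
      Real.log (N / min (a * N ^ (-k)) (1 / 2)) ≤ C * Real.log N := by
  obtain ⟨s, hs, hle⟩ := exists_le_exp_mul (a⁻¹ + 2)
  refine ⟨1 + k + s, by linarith, fun {N} hN => ?_⟩
  have hN₀ : 0 < N := two_pos.trans_le hN
  have hlog : 0 ≤ Real.log N := Real.log_nonneg (one_le_two.trans hN)
  have has := hle _ (Real.log_le_log two_pos hN)
  have hmin : Real.exp (-((k + s) * Real.log N)) ≤ min (a * N ^ (-k)) (1 / 2) := by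
    refine le_min ?_ ?_
    · rw [add_comm k, add_mul, neg_add, Real.exp_add, ← mul_neg k, mul_comm k, neg_mul_comm,
        ← Real.rpow_def_of_pos hN₀]
      gcongr
      rw [Real.exp_neg, inv_le_comm₀ (Real.exp_pos _) ha]
      linarith
    · rw [Real.exp_neg, one_div]
      gcongr
      calc (2 : ℝ) ≤ Real.exp (s * Real.log N) := by linarith [inv_pos.2 ha]
        _ ≤ Real.exp ((k + s) * Real.log N) := by gcongr; linarith
  have := (Real.exp_pos _).trans_le hmin
  rw [← Real.log_exp ((1 + k + s) * _)]
  refine Real.log_le_log (by positivity) ?_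
  calc N / min (a * N ^ (-k)) (1 / 2) ≤ N / Real.exp (-((k + s) * Real.log N)) := by gcongr
    _ = Real.exp ((1 + k + s) * Real.log N) := by
      nth_rewrite 1 [← Real.exp_log hN₀]
      rw [← Real.exp_sub]
      ring_nf

theorem exp_mul_sq_le_rpow_mul_log {N C C' x : ℝ} (hN : 0 < N) (hC : 0 ≤ C) (hx₀ : 0 ≤ x)
    (hx : x ≤ C' * Real.log N) : Real.exp (C * x ^ 2) ≤ N ^ (C * C' ^ 2 * Real.log N) := by
  rw [Real.rpow_def_of_pos hN, Real.exp_le_exp]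
  calc C * x ^ 2 ≤ C * (C' * Real.log N) ^ 2 := by gcongr
    _ = Real.log N * (C * C' ^ 2 * Real.log N) := by ring

theorem mainTheorem3_general (d z : ℕ) (hd : 0 < d) (Δ c p q : ℝ) (hΔ : 0 < Δ) (hc : 1 ≤ c)
    (hp : 0 ≤ p) (hq : 0 ≤ q) :
    (∃ C : ℝ, 0 < C ∧
      ∀ (V : Type*) [Fintype V] [DecidableEq V] [Nonempty V] (G : SimpleGraph V)
        [DecidableRel G.Adj], (∀ v, G.degree v ≤ z) →
        ∀ h : EdgeInteraction G d, h.HasGap Δ → h.PolynomialDensityOfStates c p q →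
        ∀ ord : Fin (Fintype.card G.edgeSet) ≃ G.edgeSet,
        ∀ ε : ℝ, 0 < ε → ε < 1 →
          ∃ (β : ℝ) (M L D : ℕ), 0 ≤ β ∧ 0 < M ∧
            β ≤ C * Real.log (Fintype.card V / ε) ∧
            (D : ℝ) ≤ Real.exp (C * Real.log (Fintype.card V / ε) ^ 2) ∧
            h.GroundStateApproximation ord ε β M L D) ∧
    (∀ a k : ℝ, 0 < a → 0 ≤ k → ∃ C : ℝ, 0 < C ∧
      ∀ (V : Type*) [Fintype V] [DecidableEq V] [Nonempty V] (G : SimpleGraph V)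
        [DecidableRel G.Adj], (∀ v, G.degree v ≤ z) →
        ∀ h : EdgeInteraction G d, h.HasGap Δ → h.PolynomialDensityOfStates c p q →
        ∀ ord : Fin (Fintype.card G.edgeSet) ≃ G.edgeSet,
        ∀ ε : ℝ, a * (Fintype.card V : ℝ) ^ (-k) ≤ ε →
          ∃ (β : ℝ) (M L D : ℕ), 0 ≤ β ∧ 0 < M ∧
            β ≤ C * Real.log (Fintype.card V) ∧
            (D : ℝ) ≤ (Fintype.card V : ℝ) ^ (C * Real.log (Fintype.card V)) ∧
            h.GroundStateApproximation ord ε β M L D) := by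
  constructor
  · obtain ⟨C, hC, happrox⟩ := exists_groundStateApproximation_of_two_le_card hd hΔ hc hp hq
    refine ⟨C, hC, fun V _ _ _ G _ hdeg h hgap hD ord ε hε hε_one => ?_⟩
    rcases (Nat.one_le_iff_ne_zero.2 (Fintype.card_ne_zero (α := V))).eq_or_lt with hV | hV
    · refine h.exists_groundStateApproximation_of_card_eq_one hd hV.symm ord hε ?_
        (Real.one_le_exp (by positivity))
      rw [← hV, Nat.cast_one]
      exact mul_nonneg hC.le (Real.log_nonneg ((one_le_div hε).2 hε_one.le))
    · exact happrox hV hdeg hgap hD ord hε hε_one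
  · intro a k ha hk
    obtain ⟨C, hC, happrox⟩ := exists_groundStateApproximation_of_two_le_card hd hΔ hc hp hq
    obtain ⟨C', hC', hlog⟩ := exists_log_div_min_rpow_le ha hk
    refine ⟨C * C' ^ 2, by positivity, fun V _ _ _ G _ hdeg h hgap hD ord ε hε => ?_⟩
    rcases (Nat.one_le_iff_ne_zero.2 (Fintype.card_ne_zero (α := V))).eq_or_lt with hV | hV
    · exact h.exists_groundStateApproximation_of_card_eq_one hd hV.symm ord
        (lt_of_lt_of_le (by positivity) hε) (by simp [← hV]) (by simp [← hV])
    · have hN : (2 : ℝ) ≤ Fintype.card V := Nat.ofNat_le_cast.2 hV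
      specialize hlog hN
      have hε'_one := (min_le_right (a * (Fintype.card V : ℝ) ^ (-k)) (1 / 2)).trans_lt
        one_half_lt_one
      have hε' : 0 < min (a * (Fintype.card V : ℝ) ^ (-k)) (1 / 2) := by positivity
      have hΛ₀ := (Real.log_nonneg one_le_two).trans (log_two_le_log_div hN hε' hε'_one.le)
      obtain ⟨β, M, L, D, hβ, hM, hβ_le, hD_le, hGSA⟩ :=
        happrox hV hdeg hgap hD ord hε' hε'_one
      refine ⟨β, M, L, D, hβ, hM, hβ_le.trans ?_, hD_le.trans
        (exp_mul_sq_le_rpow_mul_log (two_pos.trans_le hN) hC.le hΛ₀ hlog),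
        hGSA.mono ((min_le_left _ _).trans hε)⟩
      rw [mul_assoc]
      gcongr
      nlinarith

end

theorem mainTheorem3 (d z : ℕ) (hd : 0 < d) (Δ c p q : ℝ) (hΔ : 0 < Δ) (hc : 1 ≤ c)
    (hp : 0 ≤ p) (hq : 0 ≤ q) :
    (∃ C : ℝ, 0 < C ∧
      ∀ (V : Type*) [Fintype V] [DecidableEq V] (G : SimpleGraph V) [DecidableRel G.Adj],
        G.Connected → (∀ v, G.degree v ≤ z) →
        ∀ h : EdgeInteraction G d, h.HasGap Δ → h.PolynomialDensityOfStates c p q →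
        ∀ ord : Fin (Fintype.card G.edgeSet) ≃ G.edgeSet,
        ∀ ε : ℝ, 0 < ε → ε < 1 →
          ∃ (β : ℝ) (M L D : ℕ), 0 ≤ β ∧ 0 < M ∧
            β ≤ C * Real.log (Fintype.card V / ε) ∧
            (D : ℝ) ≤ Real.exp (C * Real.log (Fintype.card V / ε) ^ 2) ∧
            h.GroundStateApproximation ord ε β M L D) ∧
    (∀ a k : ℝ, 0 < a → 0 ≤ k → ∃ C : ℝ, 0 < C ∧
      ∀ (V : Type*) [Fintype V] [DecidableEq V] (G : SimpleGraph V) [DecidableRel G.Adj],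
        G.Connected → (∀ v, G.degree v ≤ z) →
        ∀ h : EdgeInteraction G d, h.HasGap Δ → h.PolynomialDensityOfStates c p q →
        ∀ ord : Fin (Fintype.card G.edgeSet) ≃ G.edgeSet,
        ∀ ε : ℝ, a * (Fintype.card V : ℝ) ^ (-k) ≤ ε →
          ∃ (β : ℝ) (M L D : ℕ), 0 ≤ β ∧ 0 < M ∧
            β ≤ C * Real.log (Fintype.card V) ∧
            (D : ℝ) ≤ (Fintype.card V : ℝ) ^ (C * Real.log (Fintype.card V)) ∧
            h.GroundStateApproximation ord ε β M L D) :=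
  let ⟨⟨C, hC, happrox⟩, hpoly⟩ := mainTheorem3_general d z hd Δ c p q hΔ hc hp hq
  ⟨⟨C, hC, fun V _ _ G _ hG => have := hG.nonempty; happrox V G⟩, fun a k ha hk =>
    let ⟨C, hC, happrox⟩ := hpoly a k ha hk
    ⟨C, hC, fun V _ _ G _ hG => have := hG.nonempty; happrox V G⟩⟩
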